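/- **Setting.** An *interval* is $[a,b]=\{x\in\mathbb R\mid a\le x\le b\}$ with $a\in\mathbb R\cup\{-\infty\}$, $b\in\mathbb R\cup\{\infty\}$, $a\le b$; $\mathbb I$ is the set of intervals, and a box in $\mathbb R^n$ is a product of $n$ intervals. For $f:\mathbb R^n\to\mathbb R$ put $f^{\mathbb I}(I_1,\dots,I_n):=[\inf F,\sup F]$ with $F=f(I_1\times\dots\times I_n)$. Let $\mathcal F$ be a set of measurable *primitive functions* $f:\mathbb R^{|f|}\to\mathbb R$, $|f|\ge 0$. SPCF is the simply typed (types $\alpha::=\mathsf R\mid\alpha\to\alpha$) call-by-value language with terms $$M::=x\mid \underline r\mid\lambda x.M\mid\mu^\varphi_x.M\mid M\,M\mid \mathsf{if}(M,M,M)\mid f(M_1,\dots,M_{|f|})\mid\mathsf{sample}\mid\mathsf{score}(M)\qquad(r\in\mathbb R,\ f\in\mathcal F),$$ where $\mu^\varphi_x.M$ is the recursive function $\varphi$ with argument $x$ and body $M$. A program is a closed term $P:\mathsf R$. *Semantics.* Configurations $(M,\boldsymbol s,w)$ consist of a closed term, a trace $\boldsymbol s\in\mathbb T:=\bigcup_n[0,1]^n$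 and a weight $w\ge0$. Besides the usual call-by-value reductions of applications (with left-to-right evaluation), $\mathsf{sample}$ reduces to the first entry of the trace, which is removed; $f(\underline r_1,\dots,\underline r_{|f|})$ reduces to $\underline{f(r_1,\dots,r_{|f|})}$; $\mathsf{if}(\underline r,N,Q)$ reduces to $N$ if $r\le0$ and to $Q$ if $r>0$; and if $r\ge0$, $\mathsf{score}(\underline r)$ reduces to $\underline r$ and multiplies the weight by $r$. If $(P,\boldsymbol s,1)\to^*(\underline r,\langle\rangle,w)$, the trace is terminating, with value $\mathrm{val}_P(\boldsymbol s)=r$ and weight $\mathrm{wt}_P(\boldsymbol s)=w$. With $\mu_{\mathbb T}$ the sum of the Lebesgue measures on the cubes $[0,1]^n$, $$[\![P]\!](U):=\int_{\mathrm{val}_P^{-1}(U)}\mathrm{wt}_P\,d\mu_{\mathbb T}\in[0,\infty],$$ and $P$ is *almost surely terminating* if $\mu_{\mathbb T}(\mathrm{val}_P^{-1}(\mathbb R))=1$. *Interval semantics.* An interval trace is a finite sequence of intervals with endpoints in $[0,1]$. Interval reduction is the same with intervals as literals and as weights ($r$ is read as $[r,r]$, and the initial weight is $[1,1]$): $\mathsf{sample}$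 reduces to the first interval of the trace, primitive functions act by $f^{\mathbb I}$, $\mathsf{if}([a,b],N,Q)$ reduces to $N$ if $b\le 0$ and to $Q$ if $a>0$, and is stuck otherwise, and $\mathsf{score}([a,b])$, for $a\ge 0$, reduces to $[a,b]$ and multiplies the weight by $[a,b]$ with $\times^{\mathbb I}$. If $P$ reduces on $\boldsymbol t$ to $J$ with weight $W$, the trace being used up, put $\mathrm{val}^{\mathbb I}_P(\boldsymbol t)=J$ and $\mathrm{wt}^{\mathbb I}_P(\boldsymbol t)=W$; otherwise put $\mathrm{val}^{\mathbb I}_P(\boldsymbol t)=[-\infty,\infty]$ and $\mathrm{wt}^{\mathbb I}_P(\boldsymbol t)=[0,\infty]$. Let $\mathrm{vol}(\langle[a_1,b_1],\dots,[a_n,b_n]\rangle)=\prod_i(b_i-a_i)$. For a countable set $\mathcal T$ of interval traces define (with $0\cdot\infty=0$) $$\mathrm{lower}_P^{\mathcal T}(U)=\sum_{\boldsymbol t\in\mathcal T}\mathrm{vol}(\boldsymbol t)\,\min \mathrm{wt}^{\mathbb I}_P(\boldsymbol t)\,[\mathrm{val}^{\mathbb I}_P(\boldsymbol t)\subseteq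 U],\qquad \mathrm{upper}_P^{\mathcal T}(U)=\sum_{\boldsymbol t\in\mathcal T}\mathrm{vol}(\boldsymbol t)\,\sup \mathrm{wt}^{\mathbb I}_P(\boldsymbol t)\,[\mathrm{val}^{\mathbb I}_P(\boldsymbol t)\cap U\neq\emptyset].$$ $\mathcal T$ is *compatible* if any two distinct elements $\langle I_1,\dots,I_m\rangle$, $\langle J_1,\dots,J_n\rangle$ have an index $i\le\min(m,n)$ such that $I_i=[a,b]$ and $J_i=[c,d]$ satisfy $b\le c$ or $d\le a$. It is *exhaustive* if almost every infinite trace in $[0,1]^{\mathbb N}$ (product Lebesgue measure) has a finite initial segment $\langle r_1,\dots,r_n\rangle$ with $r_i\in I_i$ for all $i$, for some $\langle I_1,\dots,I_n\rangle\in\mathcal T$. **Assumption 1.** Symbolic execution of $P$ replaces the outcomes of $\mathsf{sample}$ by fresh sample variables $\alpha_1,\alpha_2,\dots$, postpones the application of primitive functions, explores both branches of each conditional and records the guards and the score values as symbolic values. Whenever a symbolic execution path of $P$ reaches a value, each sample variable occurs at most once in the returned symbolic value, at most once in each guard of the path and at most once in each score value of the path. **Assumption 2.** (i) $\mathcal F$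 is closed under composition: if $f\in\mathcal F$ has arity $m$ and each of $g_1,\dots,g_m$ belongs to $\mathcal F$ or is the identity of $\mathbb R$, then $f\circ(g_1\times\dots\times g_m)\in\mathcal F$. (ii) Every real constant, as a nullary function, belongs to $\mathcal F$. (iii) Every $f\in\mathcal F$ is boxwise continuous: there is a countable set of boxes that cover $\mathbb R^{|f|}$, any two distinct ones meeting in a null set, such that $f$ is continuous on each of them. (iv) Every $f\in\mathcal F$ is interval separable: for every interval $J$ there is a countable set of boxes whose union is contained in $f^{-1}(J)$ and differs from it by a null set. **Theorem (completeness of interval approximations).** Let $P:\mathsf R$ be an almost surely terminating SPCF program such that Assumptions 1 and 2 hold. Then for every $I\in\mathbb I$ and every $\varepsilon>0$ there is a countable, compatible and exhaustive set $\mathcal T$ of interval traces with $$\mathrm{upper}_P^{\mathcal T}(I)-\varepsilon\ \le\ [\![P]\!](I)\ \le\ \mathrm{lower}_P^{\mathcal T}(I)+\varepsilon .$$ -/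

import Mathlib

open MeasureTheory
open scoped ENNReal NNReal

noncomputable section

namespace SPCF

/-! ## Intervals -/

/-- Intervals `[lo, hi]` with `lo ∈ ℝ ∪ {-∞}`, `hi ∈ ℝ ∪ {∞}` and `lo ≤ hi`. -/
@[ext] structure Interval where
  lo : EReal
  hi : EReal
  lo_ne_top : lo ≠ ⊤
  hi_ne_bot : hi ≠ ⊥
  le : lo ≤ hi

namespace Interval

/-- The set of real numbers denoted by an interval. -/
def toSet (I : Interval) : Set ℝ := {x : ℝ | I.lo ≤ (x : EReal) ∧ (x : EReal) ≤ I.hi}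

theorem toSet_nonempty (I : Interval) : I.toSet.Nonempty := by
  obtain ⟨lo, hi, h1, h2, h3⟩ := I
  unfold toSet
  induction lo using EReal.rec with
  | top => exact absurd rfl h1
  | coe a => exact ⟨a, le_rfl, h3⟩
  | bot =>
    induction hi using EReal.rec with
    | bot => exact absurd rfl h2
    | coe b => exact ⟨b, bot_le, le_rfl⟩
    | top => exact ⟨0, bot_le, le_top⟩

/-- The degenerate interval `[r, r]`. -/
def point (r : ℝ) : Interval :=
  ⟨r, r, EReal.coe_ne_top r, EReal.coe_ne_bot r, le_rfl⟩

/-- The interval `[-∞, ∞]`. -/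
def full : Interval := ⟨⊥, ⊤, by simp, by simp, bot_le⟩

/-- The interval `[0, ∞]`. -/
def nonneg : Interval := ⟨0, ⊤, by simp, by simp, le_top⟩

/-- The interval `[inf S, sup S]` spanned by a nonempty set `S` of reals. -/
def hull (S : Set ℝ) (hS : S.Nonempty) : Interval where
  lo := sInf (Real.toEReal '' S)
  hi := sSup (Real.toEReal '' S)
  lo_ne_top := by
    obtain ⟨x, hx⟩ := hS
    exact ne_top_of_le_ne_top (EReal.coe_ne_top x) (sInf_le (Set.mem_image_of_mem _ hx))
  hi_ne_bot := by
    obtain ⟨x, hx⟩ := hS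
    exact ne_bot_of_le_ne_bot (EReal.coe_ne_bot x) (le_sSup (Set.mem_image_of_mem _ hx))
  le := by
    obtain ⟨x, hx⟩ := hS
    exact (sInf_le (Set.mem_image_of_mem _ hx)).trans (le_sSup (Set.mem_image_of_mem _ hx))

/-- The `n`-dimensional box `I₁ × ⋯ × Iₙ`. -/
def box {n : ℕ} (I : Fin n → Interval) : Set (Fin n → ℝ) := {x | ∀ i, x i ∈ (I i).toSet}

theorem box_nonempty {n : ℕ} (I : Fin n → Interval) : (box I).Nonempty :=
  ⟨fun i => Set.Nonempty.some (toSet_nonempty (I i)),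
    fun i => Set.Nonempty.some_mem (toSet_nonempty (I i))⟩

/-- The lifting of a real function to intervals: `[inf, sup]` of the image of the box. -/
def lift {n : ℕ} (f : (Fin n → ℝ) → ℝ) (I : Fin n → Interval) : Interval :=
  hull (f '' box I) ((box_nonempty I).image f)

/-- Multiplication of intervals, the lifting of multiplication of reals. -/
def mul (I J : Interval) : Interval := lift (fun x : Fin 2 → ℝ => x 0 * x 1) ![I, J]

end Interval

/-- Intervals with endpoints in `[0, 1]`. -/
structure UInterval where
  lo : unitInterval
  hi : unitInterval
  le : lo ≤ hi

/-- An interval with endpoints in `[0, 1]` as an interval. -/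
def UInterval.toInterval (J : UInterval) : Interval :=
  ⟨((J.lo : ℝ) : EReal), ((J.hi : ℝ) : EReal), EReal.coe_ne_top _, EReal.coe_ne_bot _,
    EReal.coe_le_coe_iff.2 J.le⟩

/-! ## Primitive functions -/

/-- A set of primitive functions: measurable functions `ℝⁿ → ℝ` of any arities `n ≥ 0`. -/
structure Primitives where
  fns : (n : ℕ) → Set ((Fin n → ℝ) → ℝ)
  measurable : ∀ n, ∀ f ∈ fns n, Measurable f

/-- The identity function of one real variable, as a function `ℝ¹ → ℝ`. -/
def IsIdentity {n : ℕ} (g : (Fin n → ℝ) → ℝ) : Prop := n = 1 ∧ ∀ x i, g x = x i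

/-- Closure under composition: if `f` is primitive of arity `m`, and each of `g₁, …, gₘ` is
primitive or the identity (so that some arguments may be left alone), then
`f ∘ (g₁ × ⋯ × gₘ)` is primitive. The `gᵢ` act on separate blocks of variables. -/
def Primitives.ClosedUnderComposition (F : Primitives) : Prop :=
  ∀ (m : ℕ), ∀ f ∈ F.fns m, ∀ (k : Fin m → ℕ) (g : (i : Fin m) → (Fin (k i) → ℝ) → ℝ),
    (∀ i, g i ∈ F.fns (k i) ∨ IsIdentity (g i)) →
    (fun x : Fin (∑ i, k i) → ℝ => f fun i => g i fun j => x (finSigmaFinEquiv ⟨i, j⟩)) ∈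
      F.fns (∑ i, k i)

/-- The real constants, as nullary functions, are primitive. -/
def Primitives.ContainsConstants (F : Primitives) : Prop :=
  ∀ r : ℝ, (fun _ : Fin 0 → ℝ => r) ∈ F.fns 0

/-- `f` is continuous on each member of a countable family of pairwise almost disjoint boxes
that covers `ℝⁿ`. Boxes are almost disjoint if they meet in a null set, that is, if their
interiors are disjoint. -/
def BoxwiseContinuous {n : ℕ} (f : (Fin n → ℝ) → ℝ) : Prop :=
  ∃ ℬ : Set (Fin n → Interval), ℬ.Countable ∧
    (∀ B ∈ ℬ, ∀ C ∈ ℬ, B ≠ C → volume (Interval.box B ∩ Interval.box C) = 0) ∧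
    (⋃ B ∈ ℬ, Interval.box B) = Set.univ ∧
    ∀ B ∈ ℬ, ContinuousOn f (Interval.box B)

/-- `A` is a tight subset of `B`: it is a subset, and the difference is a null set. -/
def TightSubset {n : ℕ} (A B : Set (Fin n → ℝ)) : Prop := A ⊆ B ∧ volume (B \ A) = 0

/-- The preimage of every interval has a tight subset that is a countable union of boxes. -/
def IntervalSeparable {n : ℕ} (f : (Fin n → ℝ) → ℝ) : Prop :=
  ∀ I : Interval, ∃ ℬ : Set (Fin n → Interval), ℬ.Countable ∧
    TightSubset (⋃ B ∈ ℬ, Interval.box B) (f ⁻¹' I.toSet)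

/-- The assumption on the set of primitive functions. -/
structure Primitives.Admissible (F : Primitives) : Prop where
  closed : F.ClosedUnderComposition
  constants : F.ContainsConstants
  boxwiseContinuous : ∀ n, ∀ f ∈ F.fns n, BoxwiseContinuous f
  intervalSeparable : ∀ n, ∀ f ∈ F.fns n, IntervalSeparable f

/-! ## Types and terms -/

/-- Simple types over the type of reals. -/
inductive Ty : Type
  | real : Ty
  | arrow : Ty → Ty → Ty

/-- Variables of a given type in a context, as typed de Bruijn indices. -/
inductive Var : List Ty → Ty → Type
  | zero {Γ : List Ty} {a : Ty} : Var (a :: Γ) a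
  | succ {Γ : List Ty} {a b : Ty} : Var Γ a → Var (b :: Γ) a

/-- Well-typed terms over the primitives `F`, with literals of ground type taken from `L`:
`Tm F L Γ a` is the type of terms of type `a` in the context `Γ`. Ordinary terms have
`L = ℝ`, interval terms have `L = Interval`. In `fix M` the body `M` has two bound variables:
the argument (index zero) and the recursively defined function itself (index one). -/
inductive Tm (F : Primitives) (L : Type) : List Ty → Ty → Type
  | var {Γ : List Ty} {a : Ty} (x : Var Γ a) : Tm F L Γ a
  | lit {Γ : List Ty} (r : L) : Tm F L Γ Ty.real
  | lam {Γ : List Ty} {a b : Ty} (M : Tm F L (a :: Γ) b) : Tm F L Γ (Ty.arrow a b)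
  | fix {Γ : List Ty} {a b : Ty} (M : Tm F L (a :: Ty.arrow a b :: Γ) b) :
      Tm F L Γ (Ty.arrow a b)
  | app {Γ : List Ty} {a b : Ty} (M : Tm F L Γ (Ty.arrow a b)) (N : Tm F L Γ a) : Tm F L Γ b
  | ite {Γ : List Ty} {a : Ty} (M : Tm F L Γ Ty.real) (N P : Tm F L Γ a) : Tm F L Γ a
  | prim {Γ : List Ty} {n : ℕ} (f : F.fns n) (M : Fin n → Tm F L Γ Ty.real) : Tm F L Γ Ty.real
  | sample {Γ : List Ty} : Tm F L Γ Ty.real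
  | score {Γ : List Ty} (M : Tm F L Γ Ty.real) : Tm F L Γ Ty.real

namespace Tm

variable {F : Primitives} {L L' : Type}

/-- Extension of a renaming under a binder. -/
def liftRen {Γ Δ : List Ty} (ρ : ∀ a, Var Γ a → Var Δ a) (b : Ty) :
    ∀ a, Var (b :: Γ) a → Var (b :: Δ) a
  | _, Var.zero => Var.zero
  | _, Var.succ x => Var.succ (ρ _ x)

/-- Renaming of variables. -/
def rename : {Γ : List Ty} → {a : Ty} → Tm F L Γ a →
    {Δ : List Ty} → (∀ a, Var Γ a → Var Δ a) → Tm F L Δ a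
  | _, _, var x, _, ρ => var (ρ _ x)
  | _, _, lit r, _, _ => lit r
  | _, _, lam M, _, ρ => lam (M.rename (liftRen ρ _))
  | _, _, fix M, _, ρ => fix (M.rename (liftRen (liftRen ρ _) _))
  | _, _, app M N, _, ρ => app (M.rename ρ) (N.rename ρ)
  | _, _, ite M N P, _, ρ => ite (M.rename ρ) (N.rename ρ) (P.rename ρ)
  | _, _, prim f M, _, ρ => prim f fun i => (M i).rename ρ
  | _, _, sample, _, _ => sample
  | _, _, score M, _, ρ => score (M.rename ρ)

/-- Extension of a substitution under a binder. -/
def liftSub {Γ Δ : List Ty} (θ : ∀ a, Var Γ a → Tm F L Δ a) (b : Ty) :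
    ∀ a, Var (b :: Γ) a → Tm F L (b :: Δ) a
  | _, Var.zero => var Var.zero
  | _, Var.succ x => (θ _ x).rename fun _ y => Var.succ y

/-- Capture-avoiding simultaneous substitution. -/
def subst : {Γ : List Ty} → {a : Ty} → Tm F L Γ a →
    {Δ : List Ty} → (∀ a, Var Γ a → Tm F L Δ a) → Tm F L Δ a
  | _, _, var x, _, θ => θ _ x
  | _, _, lit r, _, _ => lit r
  | _, _, lam M, _, θ => lam (M.subst (liftSub θ _))
  | _, _, fix M, _, θ => fix (M.subst (liftSub (liftSub θ _) _))
  | _, _, app M N, _, θ => app (M.subst θ) (N.subst θ)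
  | _, _, ite M N P, _, θ => ite (M.subst θ) (N.subst θ) (P.subst θ)
  | _, _, prim f M, _, θ => prim f fun i => (M i).subst θ
  | _, _, sample, _, _ => sample
  | _, _, score M, _, θ => score (M.subst θ)

/-- The substitution that extends `θ` by `N` for the variable zero. -/
def consSub {Γ Δ : List Ty} {b : Ty} (N : Tm F L Δ b) (θ : ∀ a, Var Γ a → Tm F L Δ a) :
    ∀ a, Var (b :: Γ) a → Tm F L Δ a
  | _, Var.zero => N
  | _, Var.succ x => θ _ x

/-- `M[V/x]` -/
def subst1 {a b : Ty} (M : Tm F L [a] b) (V : Tm F L [] a) : Tm F L [] b :=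
  M.subst (consSub V fun _ x => var x)

/-- `M[V/x, U/φ]` -/
def subst2 {a b c : Ty} (M : Tm F L [a, c] b) (V : Tm F L [] a) (U : Tm F L [] c) :
    Tm F L [] b :=
  M.subst (consSub V (consSub U fun _ x => var x))

/-- Change of literals. -/
def mapLit (h : L → L') : {Γ : List Ty} → {a : Ty} → Tm F L Γ a → Tm F L' Γ a
  | _, _, var x => var x
  | _, _, lit r => lit (h r)
  | _, _, lam M => lam (M.mapLit h)
  | _, _, fix M => fix (M.mapLit h)
  | _, _, app M N => app (M.mapLit h) (N.mapLit h)
  | _, _, ite M N P => ite (M.mapLit h) (N.mapLit h) (P.mapLit h)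
  | _, _, prim f M => prim f fun i => (M i).mapLit h
  | _, _, sample => sample
  | _, _, score M => score (M.mapLit h)

/-- Values: variables, literals, abstractions and fixpoints. -/
inductive IsValue : {Γ : List Ty} → {a : Ty} → Tm F L Γ a → Prop
  | var {Γ : List Ty} {a : Ty} (x : Var Γ a) : IsValue (Tm.var x)
  | lit {Γ : List Ty} (r : L) : IsValue (Tm.lit (Γ := Γ) r)
  | lam {Γ : List Ty} {a b : Ty} (M : Tm F L (a :: Γ) b) : IsValue (Tm.lam M)
  | fix {Γ : List Ty} {a b : Ty} (M : Tm F L (a :: Ty.arrow a b :: Γ) b) : IsValue (Tm.fix M)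

end Tm

/-- Programs: closed ordinary terms of type `R`. -/
abbrev Program (F : Primitives) : Type := Tm F ℝ [] Ty.real

/-! ## Call-by-value reduction

The three reduction relations below (ordinary, interval, symbolic) have the rules for
abstractions, for fixpoints and for call-by-value evaluation contexts in common. They differ in
the rules `R` for `sample`, primitive functions, conditionals and `score`, and in the part `σ`
of a configuration that is not the term. -/

section Reduction

variable {F : Primitives} {L σ : Type}

/-- One step of reduction, given the rules `R` for the other redexes. The last five
constructors are the evaluation contexts `E N`, `V E`, `if E then N else P`,
`f(V₁, …, Vᵢ₋₁, E, Mᵢ₊₁, …, Mₙ)` and `score(E)`. -/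
inductive Step (R : (a : Ty) → Tm F L [] a → σ → Tm F L [] a → σ → Prop) :
    {a : Ty} → Tm F L [] a → σ → Tm F L [] a → σ → Prop
  | beta {a b : Ty} (M : Tm F L [a] b) (V : Tm F L [] a) (s : σ) (hV : V.IsValue) :
      Step R (Tm.app (Tm.lam M) V) s (M.subst1 V) s
  | fix {a b : Ty} (M : Tm F L [a, Ty.arrow a b] b) (V : Tm F L [] a) (s : σ)
      (hV : V.IsValue) :
      Step R (Tm.app (Tm.fix M) V) s (M.subst2 V (Tm.fix M)) s
  | redex {a : Ty} {M M' : Tm F L [] a} {s s' : σ} (h : R a M s M' s') : Step R M s M' s'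
  | appLeft {a b : Ty} {M M' : Tm F L [] (Ty.arrow a b)} {s s' : σ} (N : Tm F L [] a)
      (h : Step R M s M' s') : Step R (Tm.app M N) s (Tm.app M' N) s'
  | appRight {a b : Ty} {N N' : Tm F L [] a} {s s' : σ} (V : Tm F L [] (Ty.arrow a b))
      (hV : V.IsValue) (h : Step R N s N' s') : Step R (Tm.app V N) s (Tm.app V N') s'
  | guard {a : Ty} {M M' : Tm F L [] Ty.real} {s s' : σ} (N P : Tm F L [] a)
      (h : Step R M s M' s') : Step R (Tm.ite M N P) s (Tm.ite M' N P) s'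
  | arg {n : ℕ} (f : F.fns n) (M : Fin n → Tm F L [] Ty.real) (i : Fin n)
      {M' : Tm F L [] Ty.real} {s s' : σ} (hV : ∀ j < i, (M j).IsValue)
      (h : Step R (M i) s M' s') :
      Step R (Tm.prim f M) s (Tm.prim f (Function.update M i M')) s'
  | score {M M' : Tm F L [] Ty.real} {s s' : σ} (h : Step R M s M' s') :
      Step R (Tm.score M) s (Tm.score M') s'

/-- Reduction in finitely many steps, on closed terms of a fixed type. -/
def Steps (R : (a : Ty) → Tm F L [] a → σ → Tm F L [] a → σ → Prop) {a : Ty}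
    (c c' : Tm F L [] a × σ) : Prop :=
  Relation.ReflTransGen
    (fun d d' : Tm F L [] a × σ => Step R d.1 d.2 d'.1 d'.2) c c'

end Reduction

/-! ## Trace semantics -/

section Standard

variable {F : Primitives}

/-- Redexes of the ordinary reduction. The state is a trace and a weight. -/
inductive StdRule : (a : Ty) → Tm F ℝ [] a → List unitInterval × ℝ≥0 →
    Tm F ℝ [] a → List unitInterval × ℝ≥0 → Prop
  | sample (r : unitInterval) (s : List unitInterval) (w : ℝ≥0) :
      StdRule Ty.real Tm.sample (r :: s, w) (Tm.lit (r : ℝ)) (s, w)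
  | prim {n : ℕ} (f : F.fns n) (r : Fin n → ℝ) (c : List unitInterval × ℝ≥0) :
      StdRule Ty.real (Tm.prim f fun i => Tm.lit (r i)) c (Tm.lit (f.1 r)) c
  | iteNonpos {a : Ty} (r : ℝ) (N P : Tm F ℝ [] a) (c : List unitInterval × ℝ≥0)
      (hr : r ≤ 0) : StdRule a (Tm.ite (Tm.lit r) N P) c N c
  | itePos {a : Ty} (r : ℝ) (N P : Tm F ℝ [] a) (c : List unitInterval × ℝ≥0)
      (hr : 0 < r) : StdRule a (Tm.ite (Tm.lit r) N P) c P c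
  | score (r : ℝ) (s : List unitInterval) (w : ℝ≥0) (hr : 0 ≤ r) :
      StdRule Ty.real (Tm.score (Tm.lit r)) (s, w) (Tm.lit r) (s, w * ⟨r, hr⟩)

/-- On the trace `s`, which is used up, the program returns `r` with weight `w`. -/
def Returns (P : Program F) (s : List unitInterval) (r : ℝ) (w : ℝ≥0) : Prop :=
  Steps StdRule (P, (s, 1)) (Tm.lit r, ([], w))

/-- The space of traces, the disjoint union of the cubes `[0,1]ⁿ` with its Borel structure. -/
abbrev Trace : Type := (n : ℕ) × (Fin n → unitInterval)

/-- A trace as a list. -/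
def Trace.toList (s : Trace) : List unitInterval := List.ofFn s.2

/-- The measure on traces: Lebesgue measure on each of the cubes `[0,1]ⁿ`. -/
def traceMeasure : Measure Trace :=
  Measure.sum fun n : ℕ =>
    (volume : Measure (Fin n → unitInterval)).map (Sigma.mk (β := fun n => Fin n → unitInterval) n)

open Classical in
/-- The weight of the execution on a trace; zero if the trace is not terminating. (Reduction
is deterministic, so that at most one weight is possible.) -/
def weight (P : Program F) (s : Trace) : ℝ≥0 :=
  if h : ∃ w r, Returns P s.toList r w then h.choose else 0

/-- The set of traces on which the program returns a value in `U`. -/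
def valuePreimage (P : Program F) (U : Set ℝ) : Set Trace :=
  {s | ∃ r ∈ U, ∃ w, Returns P s.toList r w}

/-- The (unnormalised) denotation of a program. -/
def denotation (P : Program F) (U : Set ℝ) : ℝ≥0∞ :=
  ∫⁻ s in valuePreimage P U, (weight P s : ℝ≥0∞) ∂traceMeasure

/-- Almost sure termination. -/
def AlmostSurelyTerminating (P : Program F) : Prop :=
  traceMeasure (valuePreimage P Set.univ) = 1

end Standard

/-! ## Interval trace semantics -/

/-- Interval traces: finite sequences of intervals with endpoints in `[0, 1]`. -/
abbrev IntervalTrace : Type := List UInterval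

section IntervalSemantics

variable {F : Primitives}

/-- Redexes of the interval reduction. The state is an interval trace and an interval
weight. -/
inductive IntRule : (a : Ty) → Tm F Interval [] a → IntervalTrace × Interval →
    Tm F Interval [] a → IntervalTrace × Interval → Prop
  | sample (J : UInterval) (t : IntervalTrace) (w : Interval) :
      IntRule Ty.real Tm.sample (J :: t, w) (Tm.lit J.toInterval) (t, w)
  | prim {n : ℕ} (f : F.fns n) (J : Fin n → Interval) (c : IntervalTrace × Interval) :
      IntRule Ty.real (Tm.prim f fun i => Tm.lit (J i)) c (Tm.lit (Interval.lift f.1 J)) c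
  | iteNonpos {a : Ty} (J : Interval) (N P : Tm F Interval [] a)
      (c : IntervalTrace × Interval) (hJ : J.hi ≤ 0) : IntRule a (Tm.ite (Tm.lit J) N P) c N c
  | itePos {a : Ty} (J : Interval) (N P : Tm F Interval [] a)
      (c : IntervalTrace × Interval) (hJ : 0 < J.lo) : IntRule a (Tm.ite (Tm.lit J) N P) c P c
  | score (J : Interval) (t : IntervalTrace) (w : Interval) (hJ : 0 ≤ J.lo) :
      IntRule Ty.real (Tm.score (Tm.lit J)) (t, w) (Tm.lit J) (t, w.mul J)

/-- On the interval trace `t`, which is used up, the program returns the interval `J` with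
interval weight `w`. -/
def IntReturns (P : Program F) (t : IntervalTrace) (J w : Interval) : Prop :=
  Steps IntRule (P.mapLit Interval.point, (t, Interval.point 1)) (Tm.lit J, ([], w))

open Classical in
/-- The interval weight on an interval trace. -/
def intervalWeight (P : Program F) (t : IntervalTrace) : Interval :=
  if h : ∃ w J, IntReturns P t J w then h.choose else Interval.nonneg

open Classical in
/-- The interval value on an interval trace. -/
def intervalValue (P : Program F) (t : IntervalTrace) : Interval :=
  if h : ∃ J w, IntReturns P t J w then h.choose else Interval.full

/-- The volume of an interval trace, the product of the lengths of its intervals. -/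
def volumeOf (t : IntervalTrace) : ℝ≥0∞ :=
  (t.map fun J => ENNReal.ofReal ((J.hi : ℝ) - (J.lo : ℝ))).prod

open Classical in
/-- The lower bound on the denotation. (The endpoints of interval weights are
nonnegative.) -/
def lowerBound (P : Program F) (T : Set IntervalTrace) (U : Set ℝ) : ℝ≥0∞ :=
  ∑' t : T, volumeOf t.1 * (intervalWeight P t.1).lo.toENNReal *
    (if (intervalValue P t.1).toSet ⊆ U then 1 else 0)

open Classical in
/-- The upper bound on the denotation, with `0 * ∞ = 0`. -/
def upperBound (P : Program F) (T : Set IntervalTrace) (U : Set ℝ) : ℝ≥0∞ :=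
  ∑' t : T, volumeOf t.1 * (intervalWeight P t.1).hi.toENNReal *
    (if ((intervalValue P t.1).toSet ∩ U).Nonempty then 1 else 0)

end IntervalSemantics

/-- Intervals are almost disjoint if they have at most an endpoint in common. -/
def AlmostDisjoint (I J : UInterval) : Prop := I.hi ≤ J.lo ∨ J.hi ≤ I.lo

/-- Two interval traces are compatible if they are almost disjoint at some common index. -/
def CompatiblePair (t t' : IntervalTrace) : Prop :=
  ∃ (i : ℕ) (h : i < t.length) (h' : i < t'.length), AlmostDisjoint t[i] t'[i]

/-- A set of interval traces is compatible if its elements are pairwise compatible. -/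
def Compatible (T : Set IntervalTrace) : Prop := T.Pairwise CompatiblePair

/-- The infinite traces with an initial segment that is contained in `t`. -/
def cover (t : IntervalTrace) : Set (ℕ → unitInterval) :=
  {u | ∀ (i : ℕ) (h : i < t.length), t[i].lo ≤ u i ∧ u i ≤ t[i].hi}

/-- The product measure on infinite traces. -/
def infiniteTraceMeasure : Measure (ℕ → unitInterval) :=
  Measure.infinitePi fun _ : ℕ => (volume : Measure unitInterval)

/-- A set of interval traces is exhaustive if it covers almost all infinite traces. -/
def Exhaustive (T : Set IntervalTrace) : Prop :=
  infiniteTraceMeasure (⋃ t ∈ T, cover t)ᶜ = 0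

/-! ## Symbolic execution -/

section Symbolic

variable {F : Primitives}

/-- Symbolic values of ground type: literals, sample variables (`sampleVar i` is `αᵢ₊₁`), and
postponed applications of primitive functions. -/
inductive SVal (F : Primitives) : Type
  | const (r : ℝ) : SVal F
  | sampleVar (i : ℕ) : SVal F
  | app {n : ℕ} (f : F.fns n) (v : Fin n → SVal F) : SVal F

/-- The number of occurrences of a sample variable in a symbolic value. -/
def SVal.occurrences (i : ℕ) : SVal F → ℕ
  | const _ => 0
  | sampleVar j => if i = j then 1 else 0
  | app _ v => ∑ k, (v k).occurrences i

/-- Every sample variable occurs at most once. -/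
def SVal.AffineInSamples (v : SVal F) : Prop := ∀ i, v.occurrences i ≤ 1

/-- The relations in symbolic constraints. -/
inductive Cmp : Type
  | le | lt | ge | gt

/-- Symbolic constraints `value ⋈ bound`. -/
structure Constraint (F : Primitives) where
  value : SVal F
  rel : Cmp
  bound : ℝ

/-- The state of symbolic execution: the number `n` of sample variables used so far, the
constraints `Δ` and the score values `Ξ` recorded so far. -/
structure SymState (F : Primitives) where
  n : ℕ
  constraints : List (Constraint F)
  scores : List (SVal F)

/-- Redexes of symbolic execution, on terms whose ground literals are symbolic values. A
primitive function that is applied to symbolic values yields the postponed application, which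
is again a symbolic value; both branches of a conditional are explored. -/
inductive SymRule : (a : Ty) → Tm F (SVal F) [] a → SymState F →
    Tm F (SVal F) [] a → SymState F → Prop
  | sample (n : ℕ) (Δ : List (Constraint F)) (Ξ : List (SVal F)) :
      SymRule Ty.real Tm.sample ⟨n, Δ, Ξ⟩ (Tm.lit (SVal.sampleVar n)) ⟨n + 1, Δ, Ξ⟩
  | prim {m : ℕ} (f : F.fns m) (v : Fin m → SVal F) (c : SymState F) :
      SymRule Ty.real (Tm.prim f fun i => Tm.lit (v i)) c (Tm.lit (SVal.app f v)) c
  | iteNonpos {a : Ty} (v : SVal F) (N P : Tm F (SVal F) [] a) (n : ℕ)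
      (Δ : List (Constraint F)) (Ξ : List (SVal F)) :
      SymRule a (Tm.ite (Tm.lit v) N P) ⟨n, Δ, Ξ⟩ N ⟨n, ⟨v, Cmp.le, 0⟩ :: Δ, Ξ⟩
  | itePos {a : Ty} (v : SVal F) (N P : Tm F (SVal F) [] a) (n : ℕ)
      (Δ : List (Constraint F)) (Ξ : List (SVal F)) :
      SymRule a (Tm.ite (Tm.lit v) N P) ⟨n, Δ, Ξ⟩ P ⟨n, ⟨v, Cmp.gt, 0⟩ :: Δ, Ξ⟩
  | score (v : SVal F) (n : ℕ) (Δ : List (Constraint F)) (Ξ : List (SVal F)) :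
      SymRule Ty.real (Tm.score (Tm.lit v)) ⟨n, Δ, Ξ⟩ (Tm.lit v) ⟨n, ⟨v, Cmp.ge, 0⟩ :: Δ, v :: Ξ⟩

/-- The symbolic paths of a program: its symbolic execution reaches the value `v` in the
state `c`. -/
def IsSymPath (P : Program F) (v : SVal F) (c : SymState F) : Prop :=
  Steps SymRule (P.mapLit SVal.const, ⟨0, [], []⟩) (Tm.lit v, c)

/-- The assumption on the use of samples: on every symbolic path, each sample variable occurs
at most once in the return value, in each constraint (that is, in each guard) and in each
score value. -/
def UsesSamplesAffinely (P : Program F) : Prop :=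
  ∀ v c, IsSymPath P v c →
    v.AffineInSamples ∧
    (∀ C ∈ c.constraints, C.value.AffineInSamples) ∧
    ∀ W ∈ c.scores, W.AffineInSamples

end Symbolic

end SPCF

end

open MeasureTheory Filter Topology
open scoped ENNReal NNReal

noncomputable section

/-! Every terminating run follows a symbolic path, and a path is explored by finite branching, so
there are only countably many paths. Fix one with `n` samples. By the affine hypothesis, distinct
arguments of a postponed application share no sample variable. Closure under composition therefore
makes each recorded value a single primitive function (or the identity) of distinct coordinates of
the cube (`SVal.AffineInSamples.exists_eval_eq`), and the regularity assumed of primitives passes to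
it.

Box boundaries are null. Hence, near almost every point, such a value is continuous; and almost
every point where it lies in a given interval has a neighbourhood where it still does
(`BoxwiseContinuous.ae_continuousAt`, `IntervalSeparable.ae_preimage_mem_nhds`). The second fact
handles non-strict guards and membership of the result in `I`, where continuity is not enough.

On a small box where all subexpressions are continuous, interval evaluation loses nothing: the
arguments vary independently, and the image of a box is compact and connected, so the computed
interval is exactly the range (`SVal.AffineInSamples.evalInterval_eq`). Thus around almost every
terminating trace all small boxes are `Good`: interval execution succeeds, its value lies inside or
outside `I`, its weight has width at most `ε`, and it encloses every run in the box
(`IsSymPath.ae_eventually_good`).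

Take all good dyadic cubes of least level. Dyadic cells are nested or almost disjoint, and no
terminating trace properly extends another, so the family is compatible
(`compatible_maximalGoodCells`). It is countable and covers almost every terminating trace; by
almost sure termination its total volume is 1, which gives exhaustiveness. Both bounds sum over the
same cubes and enclose the denotation, and they differ by at most `ε` times a volume at most 1. -/

namespace SPCF

/-! ## Change of literals -/

namespace Tm

variable {F : Primitives} {L L' L'' : Type}

theorem mapLit_rename (h : L → L') {Γ : List Ty} {a : Ty} (M : Tm F L Γ a) :
    ∀ {Δ : List Ty} (ρ : ∀ a, Var Γ a → Var Δ a),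
      (M.rename ρ).mapLit h = (M.mapLit h).rename ρ := by
  induction M with
  | var x => intros; rfl
  | lit r => intros; rfl
  | lam M ih => intros; simp only [rename, mapLit, ih]
  | fix M ih => intros; simp only [rename, mapLit, ih]
  | app M N ih1 ih2 => intros; simp only [rename, mapLit, ih1, ih2]
  | ite M N P ih1 ih2 ih3 => intros; simp only [rename, mapLit, ih1, ih2, ih3]
  | prim f M ih => intros; simp only [rename, mapLit, ih]
  | sample => intros; rfl
  | score M ih => intros; simp only [rename, mapLit, ih]

theorem mapLit_liftSub (h : L → L') {Γ Δ : List Ty} (θ : ∀ a, Var Γ a → Tm F L Δ a) (b : Ty) :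
    (fun a x => (liftSub θ b a x).mapLit h) = liftSub (fun a x => (θ a x).mapLit h) b := by
  funext a x
  cases x with
  | zero => rfl
  | succ x => exact mapLit_rename h _ _

theorem mapLit_subst (h : L → L') {Γ : List Ty} {a : Ty} (M : Tm F L Γ a) :
    ∀ {Δ : List Ty} (θ : ∀ a, Var Γ a → Tm F L Δ a),
      (M.subst θ).mapLit h = (M.mapLit h).subst fun a x => (θ a x).mapLit h := by
  induction M with
  | var x => intros; rfl
  | lit r => intros; rfl
  | lam M ih => intros; simp only [subst, mapLit, ih, mapLit_liftSub]
  | fix M ih => intros; simp only [subst, mapLit, ih, mapLit_liftSub]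
  | app M N ih1 ih2 => intros; simp only [subst, mapLit, ih1, ih2]
  | ite M N P ih1 ih2 ih3 => intros; simp only [subst, mapLit, ih1, ih2, ih3]
  | prim f M ih => intros; simp only [subst, mapLit, ih]
  | sample => intros; rfl
  | score M ih => intros; simp only [subst, mapLit, ih]

theorem mapLit_consSub (h : L → L') {Γ Δ : List Ty} {b : Ty} (N : Tm F L Δ b)
    (θ : ∀ a, Var Γ a → Tm F L Δ a) :
    (fun a x => (consSub N θ a x).mapLit h) =
      consSub (N.mapLit h) fun a x => (θ a x).mapLit h := by
  funext a x
  cases x <;> rfl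

theorem mapLit_subst1 (h : L → L') {a b : Ty} (M : Tm F L [a] b) (V : Tm F L [] a) :
    (M.subst1 V).mapLit h = (M.mapLit h).subst1 (V.mapLit h) := by
  simp only [subst1, mapLit_subst, mapLit_consSub]
  rfl

theorem mapLit_subst2 (h : L → L') {a b c : Ty} (M : Tm F L [a, c] b) (V : Tm F L [] a)
    (U : Tm F L [] c) :
    (M.subst2 V U).mapLit h = (M.mapLit h).subst2 (V.mapLit h) (U.mapLit h) := by
  simp only [subst2, mapLit_subst, mapLit_consSub]
  rfl

theorem mapLit_mapLit (h : L → L') (h' : L' → L'') {Γ : List Ty} {a : Ty} (M : Tm F L Γ a) :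
    (M.mapLit h).mapLit h' = M.mapLit (h' ∘ h) := by
  induction M with
  | var x => rfl
  | lit r => rfl
  | lam M ih => simp only [mapLit, ih]
  | fix M ih => simp only [mapLit, ih]
  | app M N ih1 ih2 => simp only [mapLit, ih1, ih2]
  | ite M N P ih1 ih2 ih3 => simp only [mapLit, ih1, ih2, ih3]
  | prim f M ih => simp only [mapLit, ih]
  | sample => rfl
  | score M ih => simp only [mapLit, ih]

theorem mapLit_id {Γ : List Ty} {a : Ty} (M : Tm F L Γ a) : M.mapLit id = M := by
  induction M with
  | var x => rfl
  | lit r => rfl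
  | lam M ih => simp only [mapLit, ih]
  | fix M ih => simp only [mapLit, ih]
  | app M N ih1 ih2 => simp only [mapLit, ih1, ih2]
  | ite M N P ih1 ih2 ih3 => simp only [mapLit, ih1, ih2, ih3]
  | prim f M ih => simp only [mapLit, ih]
  | sample => rfl
  | score M ih => simp only [mapLit, ih]

theorem isValue_mapLit (h : L → L') {Γ : List Ty} {a : Ty} {M : Tm F L Γ a} :
    (M.mapLit h).IsValue ↔ M.IsValue := by
  constructor
  · intro hM
    cases M <;> first | constructor | (simp only [mapLit] at hM; cases hM)
  · intro hM
    cases hM <;> constructor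

end Tm

/-! ## Determinism of reduction -/

section Determinism

variable {F : Primitives} {L σ : Type}

/-- The terms to which the variable rules of a reduction apply. -/
inductive Redex : {a : Ty} → Tm F L [] a → Prop
  | sample : Redex Tm.sample
  | prim {n : ℕ} (f : F.fns n) (r : Fin n → L) : Redex (Tm.prim f fun i => Tm.lit (r i))
  | ite {a : Ty} (r : L) (N P : Tm F L [] a) : Redex (Tm.ite (Tm.lit r) N P)
  | score (r : L) : Redex (Tm.score (Tm.lit r))

variable {R : (a : Ty) → Tm F L [] a → σ → Tm F L [] a → σ → Prop}

theorem Step.not_isValue (hR : ∀ a M s M' s', R a M s M' s' → Redex M) {a : Ty}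
    {M M' : Tm F L [] a} {s s' : σ} (h : Step R M s M' s') : ¬ M.IsValue := by
  intro hM
  cases hM with
  | var x => cases x
  | lit r => cases h with | redex h => cases hR _ _ _ _ _ h
  | lam M => cases h with | redex h => cases hR _ _ _ _ _ h
  | fix M => cases h with | redex h => cases hR _ _ _ _ _ h

/-- The variable rules fire only on redexes whose evaluated arguments are literals, and values do
not reduce; so the position of the next step is forced. -/
theorem Step.deterministic (hR : ∀ a M s M' s', R a M s M' s' → Redex M)
    (hdet : ∀ a M s M₁ s₁ M₂ s₂, R a M s M₁ s₁ → R a M s M₂ s₂ → M₁ = M₂ ∧ s₁ = s₂) {a : Ty}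
    {M M₁ : Tm F L [] a} {s s₁ : σ} (h : Step R M s M₁ s₁) :
    ∀ {M₂ s₂}, Step R M s M₂ s₂ → M₁ = M₂ ∧ s₁ = s₂ := by
  induction h with
  | beta M V s hV =>
    intro M₂ s₂ h2
    cases h2 with
    | beta => exact ⟨rfl, rfl⟩
    | redex h => cases hR _ _ _ _ _ h
    | appLeft _ h => exact absurd (.lam _) (h.not_isValue hR)
    | appRight _ _ h => exact absurd hV (h.not_isValue hR)
  | fix M V s hV =>
    intro M₂ s₂ h2
    cases h2 with
    | fix => exact ⟨rfl, rfl⟩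
    | redex h => cases hR _ _ _ _ _ h
    | appLeft _ h => exact absurd (.fix _) (h.not_isValue hR)
    | appRight _ _ h => exact absurd hV (h.not_isValue hR)
  | redex h =>
    intro M₂ s₂ h2
    have hr := hR _ _ _ _ _ h
    cases hr with
    | sample => cases h2 with | redex h' => exact hdet _ _ _ _ _ _ _ h h'
    | prim f r =>
      cases h2 with
      | redex h' => exact hdet _ _ _ _ _ _ _ h h'
      | arg _ _ i _ h' => exact absurd (.lit _) (h'.not_isValue hR)
    | ite r N P =>
      cases h2 with
      | redex h' => exact hdet _ _ _ _ _ _ _ h h'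
      | guard _ _ h' => exact absurd (.lit _) (h'.not_isValue hR)
    | score r =>
      cases h2 with
      | redex h' => exact hdet _ _ _ _ _ _ _ h h'
      | score h' => exact absurd (.lit _) (h'.not_isValue hR)
  | appLeft N h ih =>
    intro M₂ s₂ h2
    cases h2 with
    | beta => exact absurd (.lam _) (h.not_isValue hR)
    | fix => exact absurd (.fix _) (h.not_isValue hR)
    | redex h => cases hR _ _ _ _ _ h
    | appLeft _ h' => obtain ⟨rfl, rfl⟩ := ih h'; exact ⟨rfl, rfl⟩
    | appRight _ hV _ => exact absurd hV (h.not_isValue hR)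
  | appRight V hV h ih =>
    intro M₂ s₂ h2
    cases h2 with
    | beta _ _ _ hV' => exact absurd hV' (h.not_isValue hR)
    | fix _ _ _ hV' => exact absurd hV' (h.not_isValue hR)
    | redex h => cases hR _ _ _ _ _ h
    | appLeft _ h' => exact absurd hV (h'.not_isValue hR)
    | appRight _ _ h' => obtain ⟨rfl, rfl⟩ := ih h'; exact ⟨rfl, rfl⟩
  | guard N P h ih =>
    intro M₂ s₂ h2
    cases h2 with
    | redex h' => cases hR _ _ _ _ _ h'; exact absurd (.lit _) (h.not_isValue hR)
    | guard _ _ h' => obtain ⟨rfl, rfl⟩ := ih h'; exact ⟨rfl, rfl⟩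
  | arg f M i hV h ih =>
    intro M₂ s₂ h2
    cases h2 with
    | redex h' => cases hR _ _ _ _ _ h'; exact absurd (.lit _) (h.not_isValue hR)
    | arg _ _ j hV' h' =>
      -- Left-to-right evaluation: everything left of the active argument is a value, so two
      -- different active positions contradict each other.
      rcases lt_trichotomy i j with hij | rfl | hij
      · exact absurd (hV' _ hij) (h.not_isValue hR)
      · obtain ⟨rfl, rfl⟩ := ih h'; exact ⟨rfl, rfl⟩
      · exact absurd (hV _ hij) (h'.not_isValue hR)
  | score h ih =>
    intro M₂ s₂ h2
    cases h2 with
    | redex h' => cases hR _ _ _ _ _ h'; exact absurd (.lit _) (h.not_isValue hR)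
    | score h' => obtain ⟨rfl, rfl⟩ := ih h'; exact ⟨rfl, rfl⟩

/-- Under a deterministic relation one of two runs from the same start prolongs the other, and a
value admits no prolongation. -/
theorem Steps.unique (hR : ∀ a M s M' s', R a M s M' s' → Redex M)
    (hdet : ∀ a M s M₁ s₁ M₂ s₂, R a M s M₁ s₁ → R a M s M₂ s₂ → M₁ = M₂ ∧ s₁ = s₂) {a : Ty}
    {c : Tm F L [] a × σ} {V₁ V₂ : Tm F L [] a} {s₁ s₂ : σ} (h₁ : Steps R c (V₁, s₁))
    (h₂ : Steps R c (V₂, s₂)) (hV₁ : V₁.IsValue) (hV₂ : V₂.IsValue) : V₁ = V₂ ∧ s₁ = s₂ := by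
  have hu : Relator.RightUnique
      (fun d d' : Tm F L [] a × σ => Step R d.1 d.2 d'.1 d'.2) := by
    intro x y z h h'
    obtain ⟨h1, h2⟩ := Step.deterministic hR hdet h h'
    exact Prod.ext h1 h2
  have key : ∀ {V₁ V₂ : Tm F L [] a} {s₁ s₂ : σ}, V₁.IsValue →
      Steps R (V₁, s₁) (V₂, s₂) → V₁ = V₂ ∧ s₁ = s₂ := by
    intro V₁ V₂ s₁ s₂ hV h
    rcases Relation.ReflTransGen.cases_head h with h | ⟨d, h, -⟩
    · exact Prod.ext_iff.1 h
    · exact absurd hV (Step.not_isValue hR h)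
  rcases Relation.ReflTransGen.total_of_right_unique hu h₁ h₂ with h | h
  · exact key hV₁ h
  · exact (key hV₂ h).imp Eq.symm Eq.symm

end Determinism

section Semantics

variable {F : Primitives}

theorem StdRule.redex {a : Ty} {M M' : Tm F ℝ [] a} {s s' : List unitInterval × ℝ≥0}
    (h : StdRule a M s M' s') : Redex M := by
  cases h <;> constructor

theorem IntRule.redex {a : Ty} {M M' : Tm F Interval [] a} {s s' : IntervalTrace × Interval}
    (h : IntRule a M s M' s') : Redex M := by
  cases h <;> constructor

theorem SymRule.redex {a : Ty} {M M' : Tm F (SVal F) [] a} {s s' : SymState F}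
    (h : SymRule a M s M' s') : Redex M := by
  cases h <;> constructor

theorem StdRule.deterministic {a : Ty} {M M₁ M₂ : Tm F ℝ [] a}
    {s s₁ s₂ : List unitInterval × ℝ≥0} (h₁ : StdRule a M s M₁ s₁) (h₂ : StdRule a M s M₂ s₂) :
    M₁ = M₂ ∧ s₁ = s₂ := by
  cases h₁ with
  | sample => cases h₂; exact ⟨rfl, rfl⟩
  | prim f r c =>
    -- The argument family is a function of the form `fun i => Tm.lit (r i)`, which dependent
    -- elimination cannot unify; the equation is kept aside and solved by injectivity.
    generalize hX : (Tm.prim f fun i => Tm.lit (r i)) = X at h₂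
    cases h₂ <;> simp only [Tm.prim.injEq, reduceCtorEq] at hX
    obtain ⟨rfl, h1, h2⟩ := hX
    obtain rfl := eq_of_heq h1
    have := eq_of_heq h2
    obtain rfl := funext fun i => Tm.lit.inj (congrFun this i)
    exact ⟨rfl, rfl⟩
  | iteNonpos r N P c hr =>
    cases h₂ with
    | iteNonpos => exact ⟨rfl, rfl⟩
    | itePos _ _ _ _ hr' => exact absurd hr (not_le.2 hr')
  | itePos r N P c hr =>
    cases h₂ with
    | itePos => exact ⟨rfl, rfl⟩
    | iteNonpos _ _ _ _ hr' => exact absurd hr' (not_le.2 hr)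
  | score => cases h₂; exact ⟨rfl, rfl⟩

theorem IntRule.deterministic {a : Ty} {M M₁ M₂ : Tm F Interval [] a}
    {s s₁ s₂ : IntervalTrace × Interval} (h₁ : IntRule a M s M₁ s₁) (h₂ : IntRule a M s M₂ s₂) :
    M₁ = M₂ ∧ s₁ = s₂ := by
  cases h₁ with
  | sample => cases h₂; exact ⟨rfl, rfl⟩
  | prim f r c =>
    generalize hX : (Tm.prim f fun i => Tm.lit (r i)) = X at h₂
    cases h₂ <;> simp only [Tm.prim.injEq, reduceCtorEq] at hX
    obtain ⟨rfl, h1, h2⟩ := hX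
    obtain rfl := eq_of_heq h1
    have := eq_of_heq h2
    obtain rfl := funext fun i => Tm.lit.inj (congrFun this i)
    exact ⟨rfl, rfl⟩
  | iteNonpos J N P c hJ =>
    cases h₂ with
    | iteNonpos => exact ⟨rfl, rfl⟩
    | itePos _ _ _ _ hJ' => exact absurd (J.le.trans hJ) (not_le.2 hJ')
  | itePos J N P c hJ =>
    cases h₂ with
    | itePos => exact ⟨rfl, rfl⟩
    | iteNonpos _ _ _ _ hJ' => exact absurd (J.le.trans hJ') (not_le.2 hJ)
  | score => cases h₂; exact ⟨rfl, rfl⟩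

theorem Returns.unique {P : Program F} {s : List unitInterval} {r r' : ℝ} {w w' : ℝ≥0}
    (h : Returns P s r w) (h' : Returns P s r' w') : r = r' ∧ w = w' := by
  obtain ⟨h1, h2⟩ := Steps.unique (R := StdRule) (fun _ _ _ _ _ h => StdRule.redex h)
    (fun _ _ _ _ _ _ _ => StdRule.deterministic) h h' (.lit _) (.lit _)
  exact ⟨Tm.lit.inj h1, congrArg Prod.snd h2⟩

theorem IntReturns.unique {P : Program F} {t : IntervalTrace} {J J' W W' : Interval}
    (h : IntReturns P t J W) (h' : IntReturns P t J' W') : J = J' ∧ W = W' := by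
  obtain ⟨h1, h2⟩ := Steps.unique (R := IntRule) (fun _ _ _ _ _ h => IntRule.redex h)
    (fun _ _ _ _ _ _ _ => IntRule.deterministic) h h' (.lit _) (.lit _)
  exact ⟨Tm.lit.inj h1, congrArg Prod.snd h2⟩

theorem Step.append_trace (q : List unitInterval) {a : Ty} {M M' : Tm F ℝ [] a}
    {s s' : List unitInterval × ℝ≥0} (h : Step StdRule M s M' s') :
    Step StdRule M (s.1 ++ q, s.2) M' (s'.1 ++ q, s'.2) := by
  induction h with
  | beta M V s hV => exact .beta _ _ _ hV
  | fix M V s hV => exact .fix _ _ _ hV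
  | redex h =>
    refine .redex ?_
    cases h with
    | sample => exact .sample ..
    | prim => exact .prim ..
    | iteNonpos _ _ _ _ hr => exact .iteNonpos _ _ _ _ hr
    | itePos _ _ _ _ hr => exact .itePos _ _ _ _ hr
    | score _ _ _ hr => exact .score _ _ _ hr
  | appLeft N h ih => exact .appLeft _ ih
  | appRight V hV h ih => exact .appRight _ hV ih
  | guard N P h ih => exact .guard _ _ ih
  | arg f M i hV h ih => exact .arg _ _ _ hV ih
  | score h ih => exact .score ih

/-- The set of terminating traces is prefix-free: with a longer trace the same run ends at the same
value and leaves the surplus unread. -/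
theorem Returns.append_eq_nil {P : Program F} {s q : List unitInterval} {r r' : ℝ} {w w' : ℝ≥0}
    (h : Returns P s r w) (h' : Returns P (s ++ q) r' w') : q = [] := by
  have h2 : Steps StdRule (P, (s ++ q, 1)) (Tm.lit r, (q, w)) :=
    Relation.ReflTransGen.lift (p := fun d d' => Step StdRule d.1 d.2 d'.1 d'.2)
      (fun d : Tm F ℝ [] Ty.real × (List unitInterval × ℝ≥0) => (d.1, (d.2.1 ++ q, d.2.2)))
      (fun _ _ hd => Step.append_trace q hd) _ _ h
  obtain ⟨-, h3⟩ := Steps.unique (R := StdRule) (fun _ _ _ _ _ h => StdRule.redex h)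
    (fun _ _ _ _ _ _ _ => StdRule.deterministic) h2 h' (.lit _) (.lit _)
  exact congrArg Prod.fst h3

theorem weight_eq {P : Program F} {s : Trace} {r : ℝ} {w : ℝ≥0}
    (h : Returns P s.toList r w) : weight P s = w := by
  have hex : ∃ w r, Returns P s.toList r w := ⟨w, r, h⟩
  rw [weight, dif_pos hex]
  obtain ⟨r', h'⟩ := hex.choose_spec
  exact (h'.unique h).2

theorem intervalWeight_eq {P : Program F} {t : IntervalTrace} {J W : Interval}
    (h : IntReturns P t J W) : intervalWeight P t = W := by
  have hex : ∃ W J, IntReturns P t J W := ⟨W, J, h⟩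
  rw [intervalWeight, dif_pos hex]
  obtain ⟨r', h'⟩ := hex.choose_spec
  exact (h'.unique h).2

theorem intervalValue_eq {P : Program F} {t : IntervalTrace} {J W : Interval}
    (h : IntReturns P t J W) : intervalValue P t = J := by
  have hex : ∃ J W, IntReturns P t J W := ⟨J, W, h⟩
  rw [intervalValue, dif_pos hex]
  obtain ⟨r', h'⟩ := hex.choose_spec
  exact (h'.unique h).1

end Semantics

/-! ## Evaluation of symbolic values and simulation of symbolic execution -/

section Simulation

variable {F : Primitives}

/-- The value of a symbolic value when the sample variables are given. -/
def SVal.eval (ρ : ℕ → ℝ) : SVal F → ℝ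
  | const r => r
  | sampleVar i => ρ i
  | app f v => f.1 fun k => (v k).eval ρ

/-- The interval value of a symbolic value when intervals for the sample variables are given. -/
def SVal.evalInterval (ρ : ℕ → Interval) : SVal F → Interval
  | const r => Interval.point r
  | sampleVar i => ρ i
  | app f v => Interval.lift f.1 fun k => (v k).evalInterval ρ

/-- The relation between reals denoted by a comparison symbol. -/
def Cmp.Holds : Cmp → ℝ → ℝ → Prop
  | le, x, b => x ≤ b
  | lt, x, b => x < b
  | ge, x, b => b ≤ x
  | gt, x, b => b < x

/-- All elements of an interval satisfy a comparison, in terms of the endpoints. -/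
def Cmp.HoldsInterval : Cmp → Interval → ℝ → Prop
  | le, J, b => J.hi ≤ b
  | lt, J, b => J.hi < b
  | ge, J, b => b ≤ J.lo
  | gt, J, b => b < J.lo

/-- The sample variables given by a trace. -/
def realEnv (s : List unitInterval) (i : ℕ) : ℝ := (s.getD i 0 : unitInterval)

/-- The intervals of the sample variables given by an interval trace. -/
def intervalEnv (t : IntervalTrace) (i : ℕ) : Interval :=
  (t.getD i ⟨0, 0, le_rfl⟩).toInterval

/-- The trace is long enough for a symbolic state and satisfies the recorded constraints. -/
def SymState.Satisfied (s : List unitInterval) (c : SymState F) : Prop :=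
  c.n ≤ s.length ∧ ∀ C ∈ c.constraints, C.rel.Holds (C.value.eval (realEnv s)) C.bound

/-- The interval trace is long enough for a symbolic state and satisfies the recorded
constraints. -/
def SymState.SatisfiedInterval (t : IntervalTrace) (c : SymState F) : Prop :=
  c.n ≤ t.length ∧
    ∀ C ∈ c.constraints, C.rel.HoldsInterval (C.value.evalInterval (intervalEnv t)) C.bound

/-- The weight recorded in a list of score values. -/
def scoreWeight (ρ : ℕ → ℝ) (Ξ : List (SVal F)) : ℝ≥0 :=
  Ξ.foldr (fun v w => w * (v.eval ρ).toNNReal) 1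

/-- The interval weight recorded in a list of score values. -/
def scoreInterval (ρ : ℕ → Interval) (Ξ : List (SVal F)) : Interval :=
  Ξ.foldr (fun v w => w.mul (v.evalInterval ρ)) (Interval.point 1)

/-- The ordinary state that a symbolic state stands for. -/
def SymState.toStd (s : List unitInterval) (c : SymState F) : List unitInterval × ℝ≥0 :=
  (s.drop c.n, scoreWeight (realEnv s) c.scores)

/-- The interval state that a symbolic state stands for. -/
def SymState.toInterval (t : IntervalTrace) (c : SymState F) : IntervalTrace × Interval :=
  (t.drop c.n, scoreInterval (intervalEnv t) c.scores)

theorem Tm.mapLit_prim_update {L L' : Type} (h : L → L') {Γ : List Ty} {n : ℕ} (f : F.fns n)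
    (M : Fin n → Tm F L Γ Ty.real) (i : Fin n) (N : Tm F L Γ Ty.real) :
    (Tm.prim f (Function.update M i N)).mapLit h =
      Tm.prim f (Function.update (fun j => (M j).mapLit h) i (N.mapLit h)) := by
  have : (fun j => (Function.update M i N j).mapLit h) =
      Function.update (fun j => (M j).mapLit h) i (N.mapLit h) := by
    funext j
    by_cases hj : j = i
    · subst hj; simp
    · simp [hj]
  rw [← this, Tm.mapLit]

/-! ### Shape of a term recovered from its image under a change of literals -/

section Inversion

variable {L L' : Type} {h : L → L'} {a b : Ty}

theorem Tm.mapLit_eq_app {M : Tm F L [] b} {A : Tm F L' [] (Ty.arrow a b)} {B : Tm F L' [] a}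
    (hM : M.mapLit h = Tm.app A B) :
    ∃ A' B', M = Tm.app A' B' ∧ A'.mapLit h = A ∧ B'.mapLit h = B := by
  cases M <;> simp only [Tm.mapLit, reduceCtorEq, Tm.app.injEq] at hM
  obtain ⟨rfl, h1, h2⟩ := hM
  exact ⟨_, _, rfl, eq_of_heq h1, eq_of_heq h2⟩

theorem Tm.mapLit_eq_lam {M : Tm F L [] (Ty.arrow a b)} {A : Tm F L' [a] b}
    (hM : M.mapLit h = Tm.lam A) : ∃ A', M = Tm.lam A' ∧ A'.mapLit h = A := by
  cases M <;> simp only [Tm.mapLit, reduceCtorEq, Tm.lam.injEq] at hM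
  exact ⟨_, rfl, hM⟩

theorem Tm.mapLit_eq_fix {M : Tm F L [] (Ty.arrow a b)} {A : Tm F L' [a, Ty.arrow a b] b}
    (hM : M.mapLit h = Tm.fix A) : ∃ A', M = Tm.fix A' ∧ A'.mapLit h = A := by
  cases M <;> simp only [Tm.mapLit, reduceCtorEq, Tm.fix.injEq] at hM
  exact ⟨_, rfl, hM⟩

theorem Tm.mapLit_eq_ite {M : Tm F L [] a} {A : Tm F L' [] Ty.real} {B C : Tm F L' [] a}
    (hM : M.mapLit h = Tm.ite A B C) :
    ∃ A' B' C', M = Tm.ite A' B' C' ∧ A'.mapLit h = A ∧ B'.mapLit h = B ∧ C'.mapLit h = C := by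
  cases M <;> simp only [Tm.mapLit, reduceCtorEq, Tm.ite.injEq] at hM
  exact ⟨_, _, _, rfl, hM⟩

theorem Tm.mapLit_eq_prim {M : Tm F L [] Ty.real} {n : ℕ} {f : F.fns n}
    {A : Fin n → Tm F L' [] Ty.real} (hM : M.mapLit h = Tm.prim f A) :
    ∃ A', M = Tm.prim f A' ∧ ∀ i, (A' i).mapLit h = A i := by
  cases M <;> simp only [Tm.mapLit, reduceCtorEq, Tm.prim.injEq] at hM
  obtain ⟨rfl, h1, h2⟩ := hM
  obtain rfl := eq_of_heq h1
  exact ⟨_, rfl, congrFun (eq_of_heq h2)⟩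

theorem Tm.mapLit_eq_score {M : Tm F L [] Ty.real} {A : Tm F L' [] Ty.real}
    (hM : M.mapLit h = Tm.score A) : ∃ A', M = Tm.score A' ∧ A'.mapLit h = A := by
  cases M <;> simp only [Tm.mapLit, reduceCtorEq, Tm.score.injEq] at hM
  exact ⟨_, rfl, hM⟩

theorem Tm.mapLit_eq_sample {M : Tm F L [] Ty.real}
    (hM : M.mapLit h = Tm.sample) : M = Tm.sample := by
  cases M <;> simp only [Tm.mapLit, reduceCtorEq] at hM
  rfl

theorem Tm.mapLit_eq_lit {M : Tm F L [] Ty.real} {r : L'}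
    (hM : M.mapLit h = Tm.lit r) : ∃ v, M = Tm.lit v ∧ h v = r := by
  cases M <;> simp only [Tm.mapLit, reduceCtorEq, Tm.lit.injEq] at hM
  exact ⟨_, rfl, hM⟩

end Inversion

/-- The condition `K` is put on the state after the step because a symbolic step records there the
side condition that the concrete rule needs. -/
theorem Step.map {L L' σ σ' : Type} {R : (a : Ty) → Tm F L [] a → σ → Tm F L [] a → σ → Prop}
    {R' : (a : Ty) → Tm F L' [] a → σ' → Tm F L' [] a → σ' → Prop} (h : L → L') (φ : σ → σ')
    (K : σ → Prop)
    (hR : ∀ a M s M' s', K s' → R a M s M' s' → R' a (M.mapLit h) (φ s) (M'.mapLit h) (φ s'))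
    {a : Ty} {M M' : Tm F L [] a} {s s' : σ} (hs : Step R M s M' s') (hK : K s') :
    Step R' (M.mapLit h) (φ s) (M'.mapLit h) (φ s') := by
  induction hs with
  | beta M V s hV =>
    rw [Tm.mapLit_subst1]
    exact .beta _ _ _ ((Tm.isValue_mapLit h).2 hV)
  | fix M V s hV =>
    rw [Tm.mapLit_subst2]
    exact .fix _ _ _ ((Tm.isValue_mapLit h).2 hV)
  | redex hr => exact .redex (hR _ _ _ _ _ hK hr)
  | appLeft N _ ih => exact .appLeft _ (ih hK)
  | appRight V hV _ ih => exact .appRight _ ((Tm.isValue_mapLit h).2 hV) (ih hK)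
  | guard N P _ ih => exact .guard _ _ (ih hK)
  | arg f M i hV _ ih =>
    have := Step.arg f (fun j => (M j).mapLit h) i
      (fun j hj => (Tm.isValue_mapLit h).2 (hV j hj)) (ih hK)
    rwa [← Tm.mapLit_prim_update] at this
  | score _ ih => exact .score (ih hK)

theorem Step.sym_mono {a : Ty} {M M' : Tm F (SVal F) [] a} {c c' : SymState F}
    (h : Step SymRule M c M' c') : c.n ≤ c'.n ∧ c.constraints ⊆ c'.constraints := by
  induction h with
  | redex h => cases h <;> simp
  | _ => first | exact ⟨le_rfl, fun _ h => h⟩ | assumption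

theorem SymState.Satisfied.of_step {s : List unitInterval} {a : Ty} {M M' : Tm F (SVal F) [] a}
    {c c' : SymState F} (hc : c'.Satisfied s) (h : Step SymRule M c M' c') : c.Satisfied s :=
  ⟨h.sym_mono.1.trans hc.1, fun C hC => hc.2 C (h.sym_mono.2 hC)⟩

theorem SymState.SatisfiedInterval.of_step {t : IntervalTrace} {a : Ty}
    {M M' : Tm F (SVal F) [] a} {c c' : SymState F} (hc : c'.SatisfiedInterval t)
    (h : Step SymRule M c M' c') : c.SatisfiedInterval t :=
  ⟨h.sym_mono.1.trans hc.1, fun C hC => hc.2 C (h.sym_mono.2 hC)⟩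

/-- The constraint just recorded is exactly the side condition of the ordinary rule. -/
theorem SymRule.toStd (s : List unitInterval) {a : Ty} {M M' : Tm F (SVal F) [] a}
    {c c' : SymState F} (hc : c'.Satisfied s) (h : SymRule a M c M' c') :
    StdRule a (M.mapLit (SVal.eval (realEnv s))) (c.toStd s)
      (M'.mapLit (SVal.eval (realEnv s))) (c'.toStd s) := by
  cases h with
  | sample n Δ Ξ =>
    have hn : n < s.length := hc.1
    have h1 : (s.drop n) = s[n] :: s.drop (n + 1) := List.drop_eq_getElem_cons hn
    have h2 : realEnv s n = (s[n] : ℝ) := by simp [realEnv, hn]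
    simp only [Tm.mapLit, SymState.toStd, SVal.eval, h1, h2]
    exact .sample _ _ _
  | prim f v c => exact .prim _ _ _
  | iteNonpos v N P n Δ Ξ => exact .iteNonpos _ _ _ _ (hc.2 _ (List.mem_cons_self ..))
  | itePos v N P n Δ Ξ => exact .itePos _ _ _ _ (hc.2 _ (List.mem_cons_self ..))
  | score v n Δ Ξ =>
    have h0 : 0 ≤ v.eval (realEnv s) := hc.2 _ (List.mem_cons_self ..)
    have := StdRule.score (F := F) (v.eval (realEnv s)) (s.drop n) (scoreWeight (realEnv s) Ξ) h0
    have h1 : (⟨v.eval (realEnv s), h0⟩ : ℝ≥0) = (v.eval (realEnv s)).toNNReal :=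
      (Real.toNNReal_of_nonneg h0).symm
    rwa [h1] at this

theorem SymRule.toInterval (t : IntervalTrace) {a : Ty} {M M' : Tm F (SVal F) [] a}
    {c c' : SymState F} (hc : c'.SatisfiedInterval t) (h : SymRule a M c M' c') :
    IntRule a (M.mapLit (SVal.evalInterval (intervalEnv t))) (c.toInterval t)
      (M'.mapLit (SVal.evalInterval (intervalEnv t))) (c'.toInterval t) := by
  cases h with
  | sample n Δ Ξ =>
    have hn : n < t.length := hc.1
    have h1 : (t.drop n) = t[n] :: t.drop (n + 1) := List.drop_eq_getElem_cons hn
    have h2 : intervalEnv t n = t[n].toInterval := by simp [intervalEnv, hn]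
    simp only [Tm.mapLit, SymState.toInterval, SVal.evalInterval, h1, h2]
    exact .sample _ _ _
  | prim f v c => exact .prim _ _ _
  | iteNonpos v N P n Δ Ξ =>
    exact .iteNonpos _ _ _ _ (hc.2 ⟨v, Cmp.le, 0⟩ (List.mem_cons_self ..))
  | itePos v N P n Δ Ξ =>
    exact .itePos _ _ _ _ (hc.2 ⟨v, Cmp.gt, 0⟩ (List.mem_cons_self ..))
  | score v n Δ Ξ =>
    exact .score _ _ _ (hc.2 ⟨v, Cmp.ge, 0⟩ (List.mem_cons_self ..))

/-- Only the final state is known to satisfy `K`; since constraints merely accumulate, `K` travels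
backwards, whence the induction from the end of the run. -/
theorem Steps.sym_map {L' σ' : Type}
    {R' : (a : Ty) → Tm F L' [] a → σ' → Tm F L' [] a → σ' → Prop} (h : SVal F → L')
    (φ : SymState F → σ') (K : SymState F → Prop)
    (hK : ∀ {a : Ty} {M M' : Tm F (SVal F) [] a} {c c' : SymState F}, K c' →
      Step SymRule M c M' c' → K c)
    (hR : ∀ a M s M' s', K s' → SymRule a M s M' s' →
      R' a (M.mapLit h) (φ s) (M'.mapLit h) (φ s'))
    {a : Ty} {d d' : Tm F (SVal F) [] a × SymState F} (hs : Steps SymRule d d') (hd : K d'.2) :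
    Steps R' (d.1.mapLit h, φ d.2) (d'.1.mapLit h, φ d'.2) := by
  have : Steps R' (d.1.mapLit h, φ d.2) (d'.1.mapLit h, φ d'.2) ∧ K d.2 := by
    induction hs using Relation.ReflTransGen.head_induction_on with
    | refl => exact ⟨.refl, hd⟩
    | head h1 _ ih => exact ⟨.head (Step.map h φ K hR h1 ih.2) ih.1, hK ih.2 h1⟩
  exact this.1

theorem IsSymPath.returns {P : Program F} {v : SVal F} {c : SymState F} (h : IsSymPath P v c)
    {s : List unitInterval} (hs : s.length = c.n) (hc : c.Satisfied s) :
    Returns P s (v.eval (realEnv s)) (scoreWeight (realEnv s) c.scores) := by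
  have := Steps.sym_map (R' := StdRule) (SVal.eval (realEnv s)) (SymState.toStd s)
    (SymState.Satisfied s) SymState.Satisfied.of_step
    (fun _ _ _ _ _ hc h => SymRule.toStd s hc h) h hc
  unfold Returns
  simpa [Tm.mapLit_mapLit, SymState.toStd, ← hs, Tm.mapLit, Function.comp_def, SVal.eval,
    ← Function.id_def, Tm.mapLit_id, scoreWeight] using this

theorem IsSymPath.intReturns {P : Program F} {v : SVal F} {c : SymState F}
    (h : IsSymPath P v c) {t : IntervalTrace} (ht : t.length = c.n)
    (hc : c.SatisfiedInterval t) :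
    IntReturns P t (v.evalInterval (intervalEnv t)) (scoreInterval (intervalEnv t) c.scores) := by
  have := Steps.sym_map (R' := IntRule) (SVal.evalInterval (intervalEnv t))
    (SymState.toInterval t) (SymState.SatisfiedInterval t) SymState.SatisfiedInterval.of_step
    (fun _ _ _ _ _ hc h => SymRule.toInterval t hc h) h hc
  unfold IntReturns
  change Steps IntRule (P.mapLit (fun x => Interval.point x), _) _
  simpa [Tm.mapLit_mapLit, SymState.toInterval, ← ht, Tm.mapLit, Function.comp_def,
    SVal.evalInterval, scoreInterval] using this

theorem StdRule.exists_sym {s : List unitInterval} {a : Ty} {X N : Tm F ℝ [] a}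
    {q q' : List unitInterval × ℝ≥0} (h : StdRule a X q N q') {M : Tm F (SVal F) [] a}
    {c : SymState F} (hM : M.mapLit (SVal.eval (realEnv s)) = X) (hq : c.toStd s = q)
    (hc : c.Satisfied s) : ∃ M' c', SymRule a M c M' c' ∧
      M'.mapLit (SVal.eval (realEnv s)) = N ∧ c'.toStd s = q' ∧ c'.Satisfied s := by
  obtain ⟨n, Δ, Ξ⟩ := c
  have hcons : ∀ C : Constraint F, C.rel.Holds (C.value.eval (realEnv s)) C.bound →
      ∀ Ξ', SymState.Satisfied s ⟨n, C :: Δ, Ξ'⟩ := fun C hC Ξ' =>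
    ⟨hc.1, fun D hD => by
      rcases List.mem_cons.1 hD with rfl | hD
      · exact hC
      · exact hc.2 D hD⟩
  cases h with
  | sample r q w =>
    obtain rfl := Tm.mapLit_eq_sample hM
    have h1 : s.drop n = r :: q := congrArg Prod.fst hq
    have hn : n < s.length := by
      by_contra hn
      rw [List.drop_eq_nil_of_le (not_lt.1 hn)] at h1
      cases h1
    rw [List.drop_eq_getElem_cons hn] at h1
    obtain ⟨h2, h3⟩ := List.cons.inj h1
    refine ⟨_, _, .sample n Δ Ξ, ?_, Prod.ext h3 (congrArg Prod.snd hq :), hn, hc.2⟩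
    simp [Tm.mapLit, SVal.eval, realEnv, hn, h2]
  | prim f r =>
    obtain ⟨M, rfl, h1⟩ := Tm.mapLit_eq_prim hM
    choose v hv1 hv2 using fun i => Tm.mapLit_eq_lit (h1 i)
    obtain rfl := funext hv1
    obtain rfl := funext hv2
    exact ⟨_, _, .prim f v _, rfl, hq, hc⟩
  | iteNonpos r N P _ hr =>
    obtain ⟨M, N, P, rfl, h1, rfl, rfl⟩ := Tm.mapLit_eq_ite hM
    obtain ⟨v, rfl, rfl⟩ := Tm.mapLit_eq_lit h1
    exact ⟨_, _, .iteNonpos v N P n Δ Ξ, rfl, hq, hcons ⟨v, Cmp.le, 0⟩ hr _⟩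
  | itePos r N P _ hr =>
    obtain ⟨M, N, P, rfl, h1, rfl, rfl⟩ := Tm.mapLit_eq_ite hM
    obtain ⟨v, rfl, rfl⟩ := Tm.mapLit_eq_lit h1
    exact ⟨_, _, .itePos v N P n Δ Ξ, rfl, hq, hcons ⟨v, Cmp.gt, 0⟩ hr _⟩
  | score r q w hr =>
    obtain ⟨M, rfl, h1⟩ := Tm.mapLit_eq_score hM
    obtain ⟨v, rfl, rfl⟩ := Tm.mapLit_eq_lit h1
    refine ⟨_, _, .score v n Δ Ξ, rfl, ?_, hcons ⟨v, Cmp.ge, 0⟩ hr _⟩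
    have h1 : (⟨v.eval (realEnv s), hr⟩ : ℝ≥0) = (v.eval (realEnv s)).toNNReal :=
      (Real.toNNReal_of_nonneg hr).symm
    obtain ⟨rfl, rfl⟩ := Prod.mk.inj hq
    rw [h1]
    rfl

/-- Converse of the simulation: the real values on the given trace decide which symbolic branch to
follow, and the constraint recorded there holds by that choice. -/
theorem Step.exists_sym (s : List unitInterval) {a : Ty} {X N : Tm F ℝ [] a}
    {q q' : List unitInterval × ℝ≥0} (h : Step StdRule X q N q') :
    ∀ (M : Tm F (SVal F) [] a) (c : SymState F), M.mapLit (SVal.eval (realEnv s)) = X →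
      c.toStd s = q → c.Satisfied s → ∃ M' c', Step SymRule M c M' c' ∧
        M'.mapLit (SVal.eval (realEnv s)) = N ∧ c'.toStd s = q' ∧ c'.Satisfied s := by
  induction h with
  | beta M₀ V q hV =>
    intro M c hM hq hc
    obtain ⟨M₁, V, rfl, hM₁, rfl⟩ := Tm.mapLit_eq_app hM
    obtain ⟨M₀, rfl, rfl⟩ := Tm.mapLit_eq_lam hM₁
    exact ⟨_, c, .beta M₀ V c ((Tm.isValue_mapLit _).1 hV), Tm.mapLit_subst1 .., hq, hc⟩
  | fix M₀ V q hV =>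
    intro M c hM hq hc
    obtain ⟨M₁, V, rfl, hM₁, rfl⟩ := Tm.mapLit_eq_app hM
    obtain ⟨M₀, rfl, rfl⟩ := Tm.mapLit_eq_fix hM₁
    exact ⟨_, c, .fix M₀ V c ((Tm.isValue_mapLit _).1 hV), Tm.mapLit_subst2 .., hq, hc⟩
  | redex h =>
    intro M c hM hq hc
    obtain ⟨M', c', h1, h2⟩ := h.exists_sym hM hq hc
    exact ⟨M', c', .redex h1, h2⟩
  | appLeft N h ih =>
    intro M c hM hq hc
    obtain ⟨M, N, rfl, hM₁, rfl⟩ := Tm.mapLit_eq_app hM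
    obtain ⟨M', c', h1, rfl, h2⟩ := ih M c hM₁ hq hc
    exact ⟨_, c', .appLeft N h1, rfl, h2⟩
  | appRight V hV h ih =>
    intro M c hM hq hc
    obtain ⟨V, N, rfl, rfl, hN⟩ := Tm.mapLit_eq_app hM
    obtain ⟨M', c', h1, rfl, h2⟩ := ih N c hN hq hc
    exact ⟨_, c', .appRight V ((Tm.isValue_mapLit _).1 hV) h1, rfl, h2⟩
  | guard N P h ih =>
    intro M c hM hq hc
    obtain ⟨M, N, P, rfl, hM₁, rfl, rfl⟩ := Tm.mapLit_eq_ite hM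
    obtain ⟨M', c', h1, rfl, h2⟩ := ih M c hM₁ hq hc
    exact ⟨_, c', .guard N P h1, rfl, h2⟩
  | arg f M₀ i hV h ih =>
    intro M c hM hq hc
    obtain ⟨M, rfl, hM₁⟩ := Tm.mapLit_eq_prim hM
    obtain ⟨M', c', h1, rfl, h2⟩ := ih (M i) c (hM₁ i) hq hc
    obtain rfl := funext hM₁
    exact ⟨_, c', .arg f M i (fun j hj => (Tm.isValue_mapLit _).1 (hV j hj)) h1,
      Tm.mapLit_prim_update .., h2⟩
  | score h ih =>
    intro M c hM hq hc
    obtain ⟨M, rfl, hM₁⟩ := Tm.mapLit_eq_score hM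
    obtain ⟨M', c', h1, rfl, h2⟩ := ih M c hM₁ hq hc
    exact ⟨_, c', .score h1, rfl, h2⟩

theorem Returns.exists_isSymPath {P : Program F} {s : List unitInterval} {r : ℝ} {w : ℝ≥0}
    (h : Returns P s r w) : ∃ v c, IsSymPath P v c ∧ s.length = c.n ∧ c.Satisfied s := by
  have key : ∀ d : Tm F ℝ [] Ty.real × (List unitInterval × ℝ≥0),
      Steps StdRule (P, (s, 1)) d → ∃ M c, Steps SymRule (P.mapLit SVal.const, ⟨0, [], []⟩) (M, c) ∧
        M.mapLit (SVal.eval (realEnv s)) = d.1 ∧ c.toStd s = d.2 ∧ c.Satisfied s := by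
    intro d hd
    induction hd with
    | refl =>
      refine ⟨_, _, .refl, ?_, rfl, Nat.zero_le _, by simp⟩
      rw [Tm.mapLit_mapLit]
      exact Tm.mapLit_id P
    | tail _ h1 ih =>
      obtain ⟨M, c, h2, h3, h4, h5⟩ := ih
      obtain ⟨M', c', h6, h7⟩ := Step.exists_sym s h1 M c h3 h4 h5
      exact ⟨M', c', h2.tail h6, h7⟩
  obtain ⟨M, c, h1, h2, h3, h4⟩ := key _ h
  obtain ⟨v, rfl, -⟩ := Tm.mapLit_eq_lit h2
  refine ⟨v, c, h1, ?_, h4⟩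
  -- The trace is used up, so its length is at most the number of samples drawn.
  have h5 : s.drop c.n = [] := congrArg Prod.fst h3
  exact le_antisymm (List.drop_eq_nil_iff.1 h5) h4.1

/-! ## Countability of symbolic execution -/

/-- Terms form an uncountable type because of their literals, so countability has to come from the
branching of reduction. The equation `hΓ` lets the induction run over terms in all contexts. -/
theorem Step.countable {L σ : Type} {R : (a : Ty) → Tm F L [] a → σ → Tm F L [] a → σ → Prop}
    (hR : ∀ a M s, {p : Tm F L [] a × σ | R a M s p.1 p.2}.Countable) {Γ : List Ty} {a : Ty}
    (M : Tm F L Γ a) : ∀ (hΓ : Γ = []) (s : σ),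
      {p : Tm F L [] a × σ | Step R (hΓ ▸ M) s p.1 p.2}.Countable := by
  induction M with
  | var x => intro hΓ; subst hΓ; cases x
  | lit r =>
    intro hΓ s
    subst hΓ
    refine (hR _ (Tm.lit r) s).mono ?_
    rintro ⟨N, s'⟩ h
    cases h with | redex h => exact h
  | lam M _ =>
    intro hΓ s
    subst hΓ
    refine (hR _ (Tm.lam M) s).mono ?_
    rintro ⟨N, s'⟩ h
    cases h with | redex h => exact h
  | fix M _ =>
    intro hΓ s
    subst hΓ
    refine (hR _ (Tm.fix M) s).mono ?_
    rintro ⟨N, s'⟩ h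
    cases h with | redex h => exact h
  | @app _ a b M N ih1 ih2 =>
    intro hΓ s
    subst hΓ
    have hbeta : {p : Tm F L [] b × σ |
        ∃ M₀, M = Tm.lam M₀ ∧ p = (M₀.subst1 N, s)}.Subsingleton := by
      rintro p ⟨M₀, h1, rfl⟩ q ⟨M₁, h2, rfl⟩
      obtain rfl := Tm.lam.inj (h1.symm.trans h2)
      rfl
    have hfix : {p : Tm F L [] b × σ |
        ∃ M₀, M = Tm.fix M₀ ∧ p = (M₀.subst2 N (Tm.fix M₀), s)}.Subsingleton := by
      rintro p ⟨M₀, h1, rfl⟩ q ⟨M₁, h2, rfl⟩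
      obtain rfl := Tm.fix.inj (h1.symm.trans h2)
      rfl
    refine ((((hR _ (Tm.app M N) s).union ((ih1 rfl s).image fun p => (Tm.app p.1 N, p.2))).union
      ((ih2 rfl s).image fun p => (Tm.app M p.1, p.2))).union
      (hbeta.countable.union hfix.countable)).mono ?_
    rintro ⟨M', s'⟩ h
    cases h with
    | redex h => exact .inl (.inl (.inl h))
    | appLeft _ h => exact .inl (.inl (.inr ⟨(_, _), h, rfl⟩))
    | appRight _ _ h => exact .inl (.inr ⟨(_, _), h, rfl⟩)
    | beta M₀ => exact .inr (.inl ⟨M₀, rfl, rfl⟩)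
    | fix M₀ => exact .inr (.inr ⟨M₀, rfl, rfl⟩)
  | ite M N P ih _ _ =>
    intro hΓ s
    subst hΓ
    refine ((hR _ (Tm.ite M N P) s).union
      ((ih rfl s).image fun p => (Tm.ite p.1 N P, p.2))).mono ?_
    rintro ⟨M', s'⟩ h
    cases h with
    | redex h => exact .inl h
    | guard _ _ h => exact .inr ⟨(_, _), h, rfl⟩
  | prim f M ih =>
    intro hΓ s
    subst hΓ
    refine ((hR _ (Tm.prim f M) s).union (Set.countable_iUnion fun i =>
      (ih i rfl s).image fun p => (Tm.prim f (Function.update M i p.1), p.2))).mono ?_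
    rintro ⟨M', s'⟩ h
    cases h with
    | redex h => exact .inl h
    | arg _ _ i _ h => exact .inr (Set.mem_iUnion.2 ⟨i, (_, _), h, rfl⟩)
  | sample =>
    intro hΓ s
    subst hΓ
    refine (hR _ Tm.sample s).mono ?_
    rintro ⟨N, s'⟩ h
    cases h with | redex h => exact h
  | score M ih =>
    intro hΓ s
    subst hΓ
    refine ((hR _ (Tm.score M) s).union
      ((ih rfl s).image fun p => (Tm.score p.1, p.2))).mono ?_
    rintro ⟨M', s'⟩ h
    cases h with
    | redex h => exact .inl h
    | score h => exact .inr ⟨(_, _), h, rfl⟩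

theorem SymRule.countable (a : Ty) (M : Tm F (SVal F) [] a) (c : SymState F) :
    {p : Tm F (SVal F) [] a × SymState F | SymRule a M c p.1 p.2}.Countable := by
  by_cases hM : ∃ p : Tm F (SVal F) [] a × SymState F, SymRule a M c p.1 p.2
  swap
  · exact Set.countable_empty.mono fun p hp => (hM ⟨p, hp⟩).elim
  obtain ⟨p, hp⟩ := hM
  cases hp.redex with
  | sample =>
    refine (Set.countable_singleton (Tm.lit (SVal.sampleVar c.n),
      (⟨c.n + 1, c.constraints, c.scores⟩ : SymState F))).mono ?_
    rintro ⟨N, c'⟩ h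
    cases h
    rfl
  | prim f v =>
    refine (Set.countable_singleton (Tm.lit (SVal.app f v), c)).mono ?_
    rintro ⟨N, c'⟩ h
    change SymRule _ _ _ N c' at h
    generalize hX : (Tm.prim f fun i => Tm.lit (v i)) = X at h
    cases h <;> simp only [Tm.prim.injEq, reduceCtorEq] at hX
    obtain ⟨rfl, h1, h2⟩ := hX
    obtain rfl := eq_of_heq h1
    obtain rfl := funext fun i => Tm.lit.inj (congrFun (eq_of_heq h2) i)
    rfl
  | ite v N P =>
    refine ((Set.countable_singleton (N,
      (⟨c.n, ⟨v, Cmp.le, 0⟩ :: c.constraints, c.scores⟩ : SymState F))).union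
      (Set.countable_singleton (P,
      (⟨c.n, ⟨v, Cmp.gt, 0⟩ :: c.constraints, c.scores⟩ : SymState F)))).mono ?_
    rintro ⟨N, c'⟩ h
    cases h
    · exact .inl rfl
    · exact .inr rfl
  | score v =>
    refine (Set.countable_singleton (Tm.lit v,
      (⟨c.n, ⟨v, Cmp.ge, 0⟩ :: c.constraints, v :: c.scores⟩ : SymState F))).mono ?_
    rintro ⟨N, c'⟩ h
    cases h
    rfl

theorem countable_isSymPath (P : Program F) :
    {p : SVal F × SymState F | IsSymPath P p.1 p.2}.Countable := by
  have hsteps : {d : Tm F (SVal F) [] Ty.real × SymState F |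
      Steps SymRule (P.mapLit SVal.const, ⟨0, [], []⟩) d}.Countable := by
    -- The configurations reachable in exactly `n` steps.
    let S : ℕ → Set (Tm F (SVal F) [] Ty.real × SymState F) := fun n =>
      Nat.rec {(P.mapLit SVal.const, ⟨0, [], []⟩)}
        (fun _ A => ⋃ d ∈ A, {p | Step SymRule d.1 d.2 p.1 p.2}) n
    have hS : ∀ n, (S n).Countable := by
      intro n
      induction n with
      | zero => exact Set.countable_singleton _
      | succ n ih =>
        exact ih.biUnion fun d _ => Step.countable SymRule.countable d.1 rfl d.2
    refine (Set.countable_iUnion hS).mono fun d hd => ?_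
    refine Set.mem_iUnion.2 ?_
    induction hd with
    | refl => exact ⟨0, rfl⟩
    | tail _ h ih =>
      obtain ⟨n, hn⟩ := ih
      exact ⟨n + 1, Set.mem_biUnion hn h⟩
  refine Set.Countable.preimage_of_injOn (f := fun p : SVal F × SymState F => (Tm.lit p.1, p.2))
    hsteps ?_
  rintro ⟨v, c⟩ - ⟨v', c'⟩ - h
  simpa using h

end Simulation

/-! ## Intervals and boxes -/

namespace Interval

theorem ordConnected_toSet (I : Interval) : I.toSet.OrdConnected :=
  ⟨fun _ hx _ hy _ hz => ⟨hx.1.trans (EReal.coe_le_coe_iff.2 hz.1),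
    (EReal.coe_le_coe_iff.2 hz.2).trans hy.2⟩⟩

theorem isClosed_toSet (I : Interval) : IsClosed I.toSet :=
  (isClosed_Ici.preimage continuous_coe_real_ereal).inter
    (isClosed_Iic.preimage continuous_coe_real_ereal)

theorem box_eq_pi {n : ℕ} (I : Fin n → Interval) :
    box I = Set.univ.pi fun i => (I i).toSet := by
  ext x
  simp [box]

theorem convex_box {n : ℕ} (I : Fin n → Interval) : Convex ℝ (box I) := by
  rw [box_eq_pi]
  exact convex_pi fun i _ => (ordConnected_toSet (I i)).convex

theorem toSet_eq_Icc {I : Interval} {a b : ℝ} (ha : I.lo = a) (hb : I.hi = b) :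
    I.toSet = Set.Icc a b := by
  ext x
  simp [toSet, ha, hb]

theorem toSet_point (r : ℝ) : (point r).toSet = {r} := by
  rw [toSet_eq_Icc (I := point r) rfl rfl, Set.Icc_self]

theorem toSet_full : full.toSet = Set.univ := by
  ext x
  simp [toSet, full]

theorem hull_Icc {a b : ℝ} {S : Set ℝ} (hS : S.Nonempty) (h : S = Set.Icc a b) :
    (hull S hS).lo = a ∧ (hull S hS).hi = b := by
  subst h
  have hab : a ≤ b := Set.nonempty_Icc.1 hS
  constructor
  · refine IsGLB.sInf_eq (IsLeast.isGLB ⟨⟨a, ⟨le_rfl, hab⟩, rfl⟩, ?_⟩)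
    rintro _ ⟨x, hx, rfl⟩
    exact EReal.coe_le_coe_iff.2 hx.1
  · refine IsLUB.sSup_eq (IsGreatest.isLUB ⟨⟨b, ⟨hab, le_rfl⟩, rfl⟩, ?_⟩)
    rintro _ ⟨x, hx, rfl⟩
    exact EReal.coe_le_coe_iff.2 hx.2

theorem mem_hull {S : Set ℝ} (hS : S.Nonempty) {x : ℝ} (hx : x ∈ S) :
    x ∈ (hull S hS).toSet :=
  ⟨sInf_le (Set.mem_image_of_mem _ hx), le_sSup (Set.mem_image_of_mem _ hx)⟩

theorem mul_mem_mul {I J : Interval} {x y : ℝ} (hx : x ∈ I.toSet) (hy : y ∈ J.toSet) :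
    x * y ∈ (I.mul J).toSet := by
  refine mem_hull ((box_nonempty _).image _) ⟨![x, y], fun i => ?_, by simp⟩
  fin_cases i
  · exact hx
  · exact hy

/-- The interval is contained in `[y - η, y + η]`. -/
def Within (I : Interval) (y η : ℝ) : Prop :=
  ((y - η : ℝ) : EReal) ≤ I.lo ∧ I.hi ≤ ((y + η : ℝ) : EReal)

theorem Within.abs_sub_le {I : Interval} {y η x : ℝ} (h : I.Within y η) (hx : x ∈ I.toSet) :
    |x - y| ≤ η := by
  have h1 := EReal.coe_le_coe_iff.1 (h.1.trans hx.1)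
  have h2 := EReal.coe_le_coe_iff.1 (hx.2.trans h.2)
  rw [abs_le]
  constructor <;> linarith

theorem within_hull {S : Set ℝ} (hS : S.Nonempty) {y η : ℝ} (h : ∀ x ∈ S, |x - y| ≤ η) :
    (hull S hS).Within y η := by
  constructor
  · refine le_sInf ?_
    rintro _ ⟨x, hx, rfl⟩
    have := abs_le.1 (h x hx)
    exact EReal.coe_le_coe_iff.2 (by linarith)
  · refine sSup_le ?_
    rintro _ ⟨x, hx, rfl⟩
    have := abs_le.1 (h x hx)
    exact EReal.coe_le_coe_iff.2 (by linarith)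

/-- Continuity of multiplication at `(y, z)`. -/
theorem exists_within_mul (y z : ℝ) {η : ℝ} (hη : 0 < η) : ∃ δ > 0, ∀ I J : Interval,
    I.Within y δ → J.Within z δ → (I.mul J).Within (y * z) η := by
  have hc : Continuous fun p : ℝ × ℝ => p.1 * p.2 := continuous_mul
  obtain ⟨δ, hδ, h⟩ := Metric.continuousAt_iff.1 (hc.continuousAt (x := (y, z))) η hη
  refine ⟨δ / 2, half_pos hδ, fun I J hI hJ =>
    within_hull ((box_nonempty _).image _) ?_⟩
  rintro _ ⟨x, hx, rfl⟩
  have h0 : |x 0 - y| ≤ δ / 2 := hI.abs_sub_le (hx 0)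
  have h1 : |x 1 - z| ≤ δ / 2 := hJ.abs_sub_le (hx 1)
  have := @h (x 0, x 1) (by
    rw [Prod.dist_eq, Real.dist_eq, Real.dist_eq]
    exact max_lt (by linarith) (by linarith))
  exact this.le

/-- Cutting off negative endpoints does no harm, since `ENNReal.ofReal` is monotone and subadditive.
-/
theorem Within.hi_le_lo_add {I : Interval} {y ε : ℝ} (h : I.Within y (ε / 2)) :
    I.hi.toENNReal ≤ I.lo.toENNReal + ENNReal.ofReal ε := by
  calc I.hi.toENNReal ≤ ENNReal.ofReal (y + ε / 2) := by
        rw [← EReal.real_coe_toENNReal]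
        exact EReal.toENNReal_le_toENNReal h.2
    _ = ENNReal.ofReal ((y - ε / 2) + ε) := by ring_nf
    _ ≤ ENNReal.ofReal (y - ε / 2) + ENNReal.ofReal ε := ENNReal.ofReal_add_le
    _ ≤ _ := by
        gcongr
        rw [← EReal.real_coe_toENNReal]
        exact EReal.toENNReal_le_toENNReal h.1

end Interval

/-- A box is convex, so its frontier is null; outside countably many frontiers, a point of a box is
an interior point. -/
theorem ae_box_mem_nhds {n : ℕ} {ℬ : Set (Fin n → Interval)} (hℬ : ℬ.Countable) :
    ∀ᵐ y : Fin n → ℝ, ∀ B ∈ ℬ, y ∈ Interval.box B → Interval.box B ∈ 𝓝 y := by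
  rw [ae_ball_iff hℬ]
  intro B _
  have h := (Interval.convex_box B).addHaar_frontier volume
  filter_upwards [compl_mem_ae_iff.2 h] with y hy hyB
  rw [mem_interior_iff_mem_nhds.symm]
  by_contra hi
  exact hy ⟨subset_closure hyB, hi⟩

theorem BoxwiseContinuous.ae_continuousAt {n : ℕ} {f : (Fin n → ℝ) → ℝ}
    (hf : BoxwiseContinuous f) : ∀ᵐ y, ∀ᶠ z in 𝓝 y, ContinuousAt f z := by
  obtain ⟨ℬ, hℬ, -, hcov, hcont⟩ := hf
  filter_upwards [ae_box_mem_nhds hℬ] with y hy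
  obtain ⟨B, hB, hyB⟩ := Set.mem_iUnion₂.1 (hcov.symm ▸ Set.mem_univ y : y ∈ ⋃ B ∈ ℬ, _)
  filter_upwards [eventually_eventually_nhds.2 (hy B hB hyB)] with z hz
  exact (hcont B hB).continuousAt hz

theorem IntervalSeparable.ae_preimage_mem_nhds {n : ℕ} {f : (Fin n → ℝ) → ℝ}
    (hf : IntervalSeparable f) (J : Interval) :
    ∀ᵐ y, f y ∈ J.toSet → ∀ᶠ z in 𝓝 y, f z ∈ J.toSet := by
  obtain ⟨ℬ, hℬ, hsub, hnull⟩ := hf J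
  filter_upwards [ae_box_mem_nhds hℬ, compl_mem_ae_iff.2 hnull] with y hy hy' hyJ
  have : y ∈ ⋃ B ∈ ℬ, Interval.box B := by
    by_contra hn
    exact hy' ⟨hyJ, hn⟩
  obtain ⟨B, hB, hyB⟩ := Set.mem_iUnion₂.1 this
  filter_upwards [hy B hB hyB] with z hz
  exact hsub (Set.mem_biUnion hB hz)

/-- A bare sample variable is represented by the identity, which need not be primitive; its
regularity is therefore checked by hand. -/
theorem IsIdentity.boxwiseContinuous {n : ℕ} {f : (Fin n → ℝ) → ℝ} (hf : IsIdentity f) :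
    BoxwiseContinuous f := by
  obtain ⟨rfl, hf⟩ := hf
  refine ⟨{fun _ => Interval.full}, Set.countable_singleton _, ?_, ?_, ?_⟩
  · rintro B rfl C rfl h
    exact (h rfl).elim
  · simp [Interval.box_eq_pi, Interval.toSet_full]
  · obtain rfl : f = fun x => x 0 := funext fun x => hf x 0
    exact fun _ _ => (continuous_apply 0).continuousOn

theorem IsIdentity.intervalSeparable {n : ℕ} {f : (Fin n → ℝ) → ℝ} (hf : IsIdentity f) :
    IntervalSeparable f := by
  obtain ⟨rfl, hf⟩ := hf
  intro I
  have : f ⁻¹' I.toSet = Interval.box fun _ => I := by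
    ext x
    simp [Interval.box, hf x 0]
  exact ⟨{fun _ => I}, Set.countable_singleton _, by simp [TightSubset, this]⟩

/-! ## Projections of cubes -/

/-- Injectivity of `π` makes the chosen coordinates independent. It is what allows null sets in the
space of arguments to be pulled back to null sets of samples. -/
theorem measurePreserving_cube_comp {n k : ℕ} {π : Fin k → Fin n} (hπ : π.Injective) :
    MeasurePreserving (fun (x : Fin n → unitInterval) (j : Fin k) => (x (π j) : ℝ)) volume
      (volume.restrict (Set.univ.pi fun _ => Set.Icc (0 : ℝ) 1)) := by
  have hm : Measurable fun (x : Fin n → unitInterval) (j : Fin k) => (x (π j) : ℝ) := by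
    fun_prop
  refine ⟨hm, ?_⟩
  rw [volume_pi, volume_pi, Measure.restrict_pi_pi]
  refine (Measure.pi_eq fun s hs => ?_).symm
  rw [Measure.map_apply hm (MeasurableSet.univ_pi hs)]
  -- A product with `s j` at position `π j` and the whole factor, of measure one, elsewhere.
  have h1 : (fun (x : Fin n → unitInterval) (j : Fin k) => (x (π j) : ℝ)) ⁻¹' (Set.univ.pi s) =
      Set.univ.pi (Function.extend π (fun j => (Subtype.val ⁻¹' s j : Set unitInterval))
        fun _ => Set.univ) := by
    ext x
    simp only [Set.mem_preimage, Set.mem_univ_pi]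
    constructor
    · intro h i
      by_cases hi : ∃ j, π j = i
      · obtain ⟨j, rfl⟩ := hi
        rw [hπ.extend_apply]
        exact h j
      · rw [Function.extend_apply' _ _ _ hi]
        trivial
    · intro h j
      have := h (π j)
      rwa [hπ.extend_apply] at this
  rw [h1, Measure.pi_pi]
  symm
  refine Fintype.prod_of_injective π hπ _ _ (fun i hi => ?_) fun j => ?_
  · rw [Function.extend_apply' _ _ _ hi, measure_univ]
  · rw [hπ.extend_apply]
    exact ((measurePreserving_subtype_coe measurableSet_Icc).measure_preimage
      (hs j).nullMeasurableSet).symm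

theorem ae_cube_of_ae {n k : ℕ} {π : Fin k → Fin n} (hπ : π.Injective)
    {p : (Fin k → ℝ) → Prop} (hp : ∀ᵐ y, p y) :
    ∀ᵐ x : Fin n → unitInterval, p fun j => (x (π j) : ℝ) :=
  (measurePreserving_cube_comp hπ).quasiMeasurePreserving.ae (ae_restrict_of_ae hp)

/-! ## Affine symbolic values as primitive functions -/

section Affine

variable {F : Primitives}

/-- Extension of a finite family of sample values by zeros. -/
def extend {n : ℕ} (x : Fin n → ℝ) (i : ℕ) : ℝ := if h : i < n then x ⟨i, h⟩ else 0

theorem SVal.AffineInSamples.of_app {n : ℕ} {f : F.fns n} {v : Fin n → SVal F}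
    (h : (SVal.app f v).AffineInSamples) (k : Fin n) : (v k).AffineInSamples := fun i =>
  (Finset.single_le_sum (f := fun k => (v k).occurrences i) (fun _ _ => Nat.zero_le _)
    (Finset.mem_univ k)).trans (h i)

theorem SVal.AffineInSamples.eq_of_app {n : ℕ} {f : F.fns n} {v : Fin n → SVal F}
    (h : (SVal.app f v).AffineInSamples) {k l : Fin n} {i : ℕ} (hk : 0 < (v k).occurrences i)
    (hl : 0 < (v l).occurrences i) : k = l := by
  by_contra hkl
  have h1 : ∑ m ∈ {k, l}, (v m).occurrences i ≤ ∑ m, (v m).occurrences i :=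
    Finset.sum_le_sum_of_subset (Finset.subset_univ _)
  rw [Finset.sum_pair hkl] at h1
  have h2 : ∑ m, (v m).occurrences i ≤ 1 := h i
  omega

/-- Closure under composition covers only functions acting on separate blocks of variables;
affineness ensures that the arguments of an application use disjoint blocks. The occurrence clause
carries this disjointness through the induction, where it yields injectivity of `π`. -/
theorem SVal.AffineInSamples.exists_eval_eq (hF : F.Admissible) (n : ℕ) {e : SVal F}
    (he : e.AffineInSamples) : ∃ (k : ℕ) (π : Fin k → Fin n) (f : (Fin k → ℝ) → ℝ),
      π.Injective ∧ (f ∈ F.fns k ∨ IsIdentity f) ∧ (∀ j, 0 < e.occurrences (π j)) ∧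
      ∀ x : Fin n → ℝ, e.eval (extend x) = f fun j => x (π j) := by
  induction e with
  | const r =>
    exact ⟨0, Fin.elim0, fun _ => r, fun i => i.elim0, .inl (hF.constants r), fun j => j.elim0,
      fun x => rfl⟩
  | sampleVar i =>
    by_cases hi : i < n
    · refine ⟨1, fun _ => ⟨i, hi⟩, fun x => x 0, fun _ _ _ => Subsingleton.elim _ _,
        .inr ⟨rfl, fun x i => by rw [Subsingleton.elim i 0]⟩, fun j => by simp [occurrences],
        fun x => by simp [eval, extend, hi]⟩
    -- Variables beyond the first `n` are read as zero by `extend`, hence as a nullary constant.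
    · exact ⟨0, Fin.elim0, fun _ => 0, fun i => i.elim0, .inl (hF.constants 0), fun j => j.elim0,
        fun x => by simp [eval, extend, hi]⟩
  | @app m f v ih =>
    choose k π g hπ hg hocc heq using fun l => ih l (he.of_app l)
    refine ⟨∑ l, k l, fun q => π (finSigmaFinEquiv.symm q).1 (finSigmaFinEquiv.symm q).2,
      _, ?_, .inl (hF.closed m f.1 f.2 k g hg), ?_, ?_⟩
    · intro q q' hq
      apply finSigmaFinEquiv.symm.injective
      dsimp only at hq
      generalize finSigmaFinEquiv.symm q = p at hq ⊢
      generalize finSigmaFinEquiv.symm q' = p' at hq ⊢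
      obtain ⟨l, j⟩ := p
      obtain ⟨l', j'⟩ := p'
      replace hq : π l j = π l' j' := hq
      -- A common coordinate would be a sample variable occurring in two arguments.
      obtain rfl : l = l' := he.eq_of_app (hocc l j) (hq ▸ hocc l' j')
      rw [hπ l hq]
    · intro q
      exact (hocc _ _).trans_le (Finset.single_le_sum
        (f := fun l => (v l).occurrences _) (fun _ _ => Nat.zero_le _) (Finset.mem_univ _))
    · intro x
      simp only [eval, heq]
      refine congrArg f.1 (funext fun l => congrArg (g l) (funext fun j => ?_))
      rw [Equiv.symm_apply_apply]

theorem SVal.AffineInSamples.ae_continuousAt (hF : F.Admissible) (n : ℕ) {e : SVal F}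
    (he : e.AffineInSamples) : ∀ᵐ x : Fin n → unitInterval,
      ∀ᶠ z in 𝓝 (fun i => (x i : ℝ)), ContinuousAt (fun z : Fin n → ℝ => e.eval (extend z)) z := by
  obtain ⟨k, π, f, hπ, hf, -, heq⟩ := he.exists_eval_eq hF n
  have hbc : BoxwiseContinuous f :=
    hf.elim (hF.boxwiseContinuous k f) IsIdentity.boxwiseContinuous
  have hc : Continuous fun (z : Fin n → ℝ) (j : Fin k) => z (π j) := by fun_prop
  filter_upwards [ae_cube_of_ae hπ hbc.ae_continuousAt] with x hx
  filter_upwards [hc.continuousAt.eventually hx] with z hz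
  simp only [heq]
  exact ContinuousAt.comp (f := fun (z : Fin n → ℝ) (j : Fin k) => z (π j)) hz hc.continuousAt

theorem SVal.AffineInSamples.ae_eventually_mem (hF : F.Admissible) (n : ℕ) {e : SVal F}
    (he : e.AffineInSamples) (J : Interval) : ∀ᵐ x : Fin n → unitInterval,
      e.eval (extend fun i => (x i : ℝ)) ∈ J.toSet →
        ∀ᶠ z in 𝓝 (fun i => (x i : ℝ)), e.eval (extend z) ∈ J.toSet := by
  obtain ⟨k, π, f, hπ, hf, -, heq⟩ := he.exists_eval_eq hF n
  have hbc : IntervalSeparable f :=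
    hf.elim (hF.intervalSeparable k f) IsIdentity.intervalSeparable
  have hc : Continuous fun (z : Fin n → ℝ) (j : Fin k) => z (π j) := by fun_prop
  filter_upwards [ae_cube_of_ae hπ (hbc.ae_preimage_mem_nhds J)] with x hx hxJ
  simp only [heq] at hxJ ⊢
  exact (hc.tendsto fun i => (x i : ℝ)).eventually (hx hxJ)

theorem SVal.AffineInSamples.ae_eventually_mem_of_isOpen (hF : F.Admissible) (n : ℕ)
    {e : SVal F} (he : e.AffineInSamples) {U : Set ℝ} (hU : IsOpen U) :
    ∀ᵐ x : Fin n → unitInterval, e.eval (extend fun i => (x i : ℝ)) ∈ U →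
        ∀ᶠ z in 𝓝 (fun i => (x i : ℝ)), e.eval (extend z) ∈ U := by
  filter_upwards [he.ae_continuousAt hF n] with x hx hxU
  exact hx.self_of_nhds.eventually (hU.mem_nhds hxU)

/-- Strict comparisons are open conditions and follow from continuity. Non-strict ones say that the
value lies in an unbounded closed interval, and need interval separability: a value may equal the
bound on a set of positive measure. -/
theorem SVal.AffineInSamples.ae_eventually_holds (hF : F.Admissible) (n : ℕ) {e : SVal F}
    (he : e.AffineInSamples) (r : Cmp) (b : ℝ) : ∀ᵐ x : Fin n → unitInterval,
      r.Holds (e.eval (extend fun i => (x i : ℝ))) b →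
        ∀ᶠ z in 𝓝 (fun i => (x i : ℝ)), r.Holds (e.eval (extend z)) b := by
  cases r with
  | le =>
    simpa [Interval.toSet, Cmp.Holds] using
      he.ae_eventually_mem hF n ⟨⊥, b, by simp, by simp, bot_le⟩
  | lt => exact he.ae_eventually_mem_of_isOpen hF n isOpen_Iio
  | ge =>
    simpa [Interval.toSet, Cmp.Holds] using
      he.ae_eventually_mem hF n ⟨b, ⊤, by simp, by simp, le_top⟩
  | gt => exact he.ae_eventually_mem_of_isOpen hF n isOpen_Ioi

/-- The functions given by all subexpressions that are applications are continuous on `S`. -/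
def SVal.ContinuousOnSub {n : ℕ} (S : Set (Fin n → ℝ)) : SVal F → Prop
  | const _ => True
  | sampleVar _ => True
  | app f v => ContinuousOn (fun z : Fin n → ℝ => (app f v).eval (extend z)) S ∧
      ∀ k, (v k).ContinuousOnSub S

/-- Subexpressions of an affine value are affine, and there are finitely many, so their exceptional
null sets can be united. -/
theorem SVal.AffineInSamples.ae_continuousOnSub (hF : F.Admissible) (n : ℕ) {e : SVal F}
    (he : e.AffineInSamples) : ∀ᵐ x : Fin n → unitInterval,
      ∀ᶠ S in (𝓝 (fun i => (x i : ℝ))).smallSets, e.ContinuousOnSub S := by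
  induction e with
  | const r => exact .of_forall fun x => .of_forall fun S => trivial
  | sampleVar i => exact .of_forall fun x => .of_forall fun S => trivial
  | app f v ih =>
    filter_upwards [he.ae_continuousAt hF n, ae_all_iff.2 fun k => ih k (he.of_app k)] with x h1 h2
    filter_upwards [eventually_smallSets_forall.2 h1, eventually_all.2 h2] with S h3 h4
    exact ⟨fun z hz => (h3 z hz).continuousWithinAt, h4⟩

/-- The box in real space given by a family of intervals in `[0, 1]`. -/
def realBox {n : ℕ} (B : Fin n → UInterval) : Set (Fin n → ℝ) :=
  Set.Icc (fun i => ((B i).lo : ℝ)) fun i => ((B i).hi : ℝ)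

theorem realBox_nonempty {n : ℕ} (B : Fin n → UInterval) : (realBox B).Nonempty :=
  Set.nonempty_Icc.2 fun i => (B i).le

theorem SVal.eval_congr {ρ ρ' : ℕ → ℝ} {e : SVal F}
    (h : ∀ i, 0 < e.occurrences i → ρ i = ρ' i) : e.eval ρ = e.eval ρ' := by
  induction e with
  | const r => rfl
  | sampleVar i => exact h i (by simp [occurrences])
  | app f v ih =>
    simp only [eval]
    refine congrArg f.1 (funext fun k => ?_)
    exact ih k fun i hi => h i (hi.trans_le (Finset.single_le_sum
        (f := fun l => (v l).occurrences i) (fun _ _ => Nat.zero_le _) (Finset.mem_univ k)))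

theorem intervalEnv_ofFn {n : ℕ} (B : Fin n → UInterval) (i : ℕ) :
    intervalEnv (List.ofFn B) i =
      if h : i < n then (B ⟨i, h⟩).toInterval else Interval.point 0 := by
  unfold intervalEnv
  split_ifs with h
  · simp [h]
  · rw [List.getD_eq_default _ _ (by simpa using h)]
    simp [UInterval.toInterval, Interval.point]

theorem realEnv_ofFn {n : ℕ} (x : Fin n → unitInterval) :
    realEnv (List.ofFn x) = extend fun i => (x i : ℝ) := by
  funext i
  unfold realEnv extend
  split_ifs with h
  · simp [h]
  · rw [List.getD_eq_default _ _ (by simpa using h)]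
    simp

/-- On a box on which all subexpressions are continuous, the interval value of an affine symbolic
value is exactly its range. -/
theorem SVal.AffineInSamples.evalInterval_eq {n : ℕ} {e : SVal F} (he : e.AffineInSamples)
    (B : Fin n → UInterval) (hc : e.ContinuousOnSub (realBox B)) :
    ∃ a b : ℝ, (e.evalInterval (intervalEnv (List.ofFn B))).lo = a ∧
      (e.evalInterval (intervalEnv (List.ofFn B))).hi = b ∧ a ≤ b ∧
      (fun z => e.eval (extend z)) '' realBox B = Set.Icc a b := by
  induction e with
  | const r =>
    refine ⟨r, r, rfl, rfl, le_rfl, ?_⟩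
    simp [eval, (realBox_nonempty B).image_const]
  | sampleVar i =>
    by_cases hi : i < n
    · refine ⟨(B ⟨i, hi⟩).lo, (B ⟨i, hi⟩).hi, ?_, ?_, (B ⟨i, hi⟩).le, ?_⟩
      · simp [evalInterval, intervalEnv_ofFn, hi, UInterval.toInterval]
      · simp [evalInterval, intervalEnv_ofFn, hi, UInterval.toInterval]
      · ext y
        simp only [eval, extend, hi, dif_pos, Set.mem_image]
        constructor
        · rintro ⟨z, hz, rfl⟩
          exact ⟨hz.1 _, hz.2 _⟩
        · intro hy
          refine ⟨Function.update (fun j => ((B j).lo : ℝ)) ⟨i, hi⟩ y, ?_, by simp⟩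
          constructor <;> intro j <;> by_cases hj : j = ⟨i, hi⟩
          · subst hj; simpa using hy.1
          · simp [hj]
          · subst hj; simpa using hy.2
          · simpa [hj] using (B j).le
    · refine ⟨0, 0, ?_, ?_, le_rfl, ?_⟩
      · simp [evalInterval, intervalEnv_ofFn, hi, Interval.point]
      · simp [evalInterval, intervalEnv_ofFn, hi, Interval.point]
      · simp [eval, extend, hi, (realBox_nonempty B).image_const]
  | @app m f v ih =>
    set A := (fun z => (SVal.app f v).eval (extend z)) '' realBox B with hA
    -- By induction each argument interval is the exact range of that argument; what remains is that
    -- the arguments attain their values independently.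
    have hbox : f.1 '' Interval.box (fun k => (v k).evalInterval (intervalEnv (List.ofFn B))) =
        A := by
      ext y
      constructor
      · rintro ⟨u, hu, rfl⟩
        have : ∀ k, ∃ z ∈ realBox B, (v k).eval (extend z) = u k := by
          intro k
          obtain ⟨a, b, h1, h2, -, h3⟩ := ih k (he.of_app k) (hc.2 k)
          have h4 := hu k
          rw [Interval.toSet_eq_Icc h1 h2, ← h3] at h4
          exact h4
        choose z hz hzu using this
        classical
        -- The points `z k` are glued into one: each coordinate is taken from the unique argument in
        -- which it occurs, and unused coordinates get an arbitrary value in the box.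
        let x : Fin n → ℝ := fun i =>
          if h : ∃ k, 0 < (v k).occurrences i then z h.choose i else (B i).lo
        have hx : ∀ k i, 0 < (v k).occurrences (i : Fin n) → x i = z k i := by
          intro k i hk
          have h : ∃ k, 0 < (v k).occurrences i := ⟨k, hk⟩
          simp only [x, dif_pos h]
          rw [he.eq_of_app h.choose_spec hk]
        refine ⟨x, ⟨fun i => ?_, fun i => ?_⟩, ?_⟩
        · by_cases h : ∃ k, 0 < (v k).occurrences i
          · simpa only [x, dif_pos h] using (hz _).1 i
          · simp only [x, dif_neg h, le_refl]
        · by_cases h : ∃ k, 0 < (v k).occurrences i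
          · simpa only [x, dif_pos h] using (hz _).2 i
          · simp only [x, dif_neg h]
            exact (B i).le
        · simp only [eval]
          refine congrArg f.1 (funext fun k => ?_)
          rw [← hzu k]
          refine eval_congr fun i hi => ?_
          unfold extend
          split_ifs with h
          · exact hx k ⟨i, h⟩ hi
          · rfl
      · rintro ⟨z, hz, rfl⟩
        refine ⟨fun k => (v k).eval (extend z), fun k => ?_, rfl⟩
        obtain ⟨a, b, h1, h2, -, h3⟩ := ih k (he.of_app k) (hc.2 k)
        change _ ∈ ((v k).evalInterval (intervalEnv (List.ofFn B))).toSet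
        rw [Interval.toSet_eq_Icc h1 h2, ← h3]
        exact ⟨z, hz, rfl⟩
    -- A compact connected set of reals is a closed interval, so passing to the hull adds no points.
    have hcomp : IsCompact A := isCompact_Icc.image_of_continuousOn hc.1
    have hconn : IsConnected A :=
      ⟨(realBox_nonempty B).image _, (convex_Icc _ _).isPreconnected.image _ hc.1⟩
    have hIcc := eq_Icc_of_connected_compact hconn hcomp
    obtain ⟨h1, h2⟩ := Interval.hull_Icc ((Interval.box_nonempty _).image f.1) (hbox.trans hIcc)
    exact ⟨sInf A, sSup A, h1, h2, Set.nonempty_Icc.1 (hIcc ▸ hconn.nonempty), hIcc⟩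

end Affine

/-! ## Good interval traces -/

section Good

variable {F : Primitives}

theorem Step.scores_constraints {a : Ty} {M M' : Tm F (SVal F) [] a} {c c' : SymState F}
    (h : Step SymRule M c M' c') (hc : ∀ v ∈ c.scores, ⟨v, Cmp.ge, 0⟩ ∈ c.constraints) :
    ∀ v ∈ c'.scores, ⟨v, Cmp.ge, 0⟩ ∈ c'.constraints := by
  induction h with
  | redex h =>
    cases h with
    | sample => exact hc
    | prim => exact hc
    | iteNonpos => exact fun v hv => List.mem_cons_of_mem _ (hc v hv)
    | itePos => exact fun v hv => List.mem_cons_of_mem _ (hc v hv)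
    | score v =>
      intro u hu
      rcases List.mem_cons.1 hu with rfl | hu
      · exact List.mem_cons_self ..
      · exact List.mem_cons_of_mem _ (hc u hu)
  | beta => exact hc
  | fix => exact hc
  | appLeft _ _ ih => exact ih hc
  | appRight _ _ _ ih => exact ih hc
  | guard _ _ _ ih => exact ih hc
  | arg _ _ _ _ _ ih => exact ih hc
  | score _ ih => exact ih hc

/-- Score values are nonnegative wherever the path constraints hold, so the truncation
`Real.toNNReal` in `scoreWeight` is harmless. -/
theorem IsSymPath.scores_constraints {P : Program F} {v : SVal F} {c : SymState F}
    (h : IsSymPath P v c) : ∀ W ∈ c.scores, ⟨W, Cmp.ge, 0⟩ ∈ c.constraints := by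
  have key : ∀ d : Tm F (SVal F) [] Ty.real × SymState F,
      Steps SymRule (P.mapLit SVal.const, ⟨0, [], []⟩) d →
        ∀ W ∈ d.2.scores, ⟨W, Cmp.ge, 0⟩ ∈ d.2.constraints := by
    intro d hd
    induction hd with
    | refl => simp
    | tail _ h1 ih => exact Step.scores_constraints h1 ih
  exact key _ h

theorem SVal.AffineInSamples.evalInterval_toSet {n : ℕ} {e : SVal F} (he : e.AffineInSamples)
    (B : Fin n → UInterval) (hc : e.ContinuousOnSub (realBox B)) :
    (e.evalInterval (intervalEnv (List.ofFn B))).toSet =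
      (fun z => e.eval (extend z)) '' realBox B := by
  obtain ⟨a, b, h1, h2, -, h3⟩ := he.evalInterval_eq B hc
  rw [Interval.toSet_eq_Icc h1 h2, h3]

/-- The endpoints of the computed interval are attained on the box, so a pointwise comparison,
strict or not, passes to them. -/
theorem SVal.AffineInSamples.holdsInterval {n : ℕ} {e : SVal F} (he : e.AffineInSamples)
    (B : Fin n → UInterval) (hc : e.ContinuousOnSub (realBox B)) {r : Cmp} {b : ℝ}
    (h : ∀ z ∈ realBox B, r.Holds (e.eval (extend z)) b) :
    r.HoldsInterval (e.evalInterval (intervalEnv (List.ofFn B))) b := by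
  obtain ⟨l, u, h1, h2, hlu, h3⟩ := he.evalInterval_eq B hc
  have hl : r.Holds l b := by
    obtain ⟨z, hz, hzl⟩ := (h3.symm ▸ ⟨le_rfl, hlu⟩ : l ∈ (fun z => e.eval (extend z)) '' realBox B)
    rw [← hzl]
    exact h z hz
  have hu : r.Holds u b := by
    obtain ⟨z, hz, hzl⟩ := (h3.symm ▸ ⟨hlu, le_rfl⟩ : u ∈ (fun z => e.eval (extend z)) '' realBox B)
    rw [← hzl]
    exact h z hz
  cases r <;> simp only [Cmp.Holds] at hl hu <;>
    simp only [Cmp.HoldsInterval, h1, h2, EReal.coe_le_coe_iff, EReal.coe_lt_coe_iff] <;> assumption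

theorem scoreWeight_mem_scoreInterval {n : ℕ} {B : Fin n → UInterval} {Ξ : List (SVal F)}
    (ha : ∀ v ∈ Ξ, v.AffineInSamples) (hc : ∀ v ∈ Ξ, v.ContinuousOnSub (realBox B))
    {z : Fin n → ℝ} (hz : z ∈ realBox B) (h0 : ∀ v ∈ Ξ, 0 ≤ v.eval (extend z)) :
    (scoreWeight (extend z) Ξ : ℝ) ∈ (scoreInterval (intervalEnv (List.ofFn B)) Ξ).toSet := by
  induction Ξ with
  | nil => simp [scoreWeight, scoreInterval, Interval.toSet_point]
  | cons v Ξ ih =>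
    simp only [List.forall_mem_cons] at ha hc h0
    have h1 := Interval.mul_mem_mul (ih ha.2 hc.2 h0.2) (y := v.eval (extend z))
      (J := v.evalInterval (intervalEnv (List.ofFn B)))
      (by rw [ha.1.evalInterval_toSet B hc.1]; exact ⟨z, hz, rfl⟩)
    have h2 : (scoreWeight (extend z) (v :: Ξ) : ℝ) =
        scoreWeight (extend z) Ξ * v.eval (extend z) := by
      simp [scoreWeight, h0.1]
    rw [h2]
    exact h1

/-! ### Interval values and weights on boxes shrinking to a point -/

section Shrinking

variable {ι : Type*} {l : Filter ι} {n : ℕ} {B : ι → Fin n → UInterval} {x : Fin n → ℝ}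

theorem SVal.AffineInSamples.eventually_within
    (hB : Tendsto (fun i => realBox (B i)) l (𝓝 x).smallSets) {e : SVal F}
    (he : e.AffineInSamples) (hc : ∀ᶠ S in (𝓝 x).smallSets, e.ContinuousOnSub S)
    (hx : ContinuousAt (fun z : Fin n → ℝ => e.eval (extend z)) x) {η : ℝ} (hη : 0 < η) :
    ∀ᶠ i in l, (e.evalInterval (intervalEnv (List.ofFn (B i)))).Within (e.eval (extend x)) η := by
  have h1 : ∀ᶠ z in 𝓝 x, |e.eval (extend z) - e.eval (extend x)| ≤ η := by
    filter_upwards [hx.eventually (Metric.ball_mem_nhds _ hη)] with z hz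
    exact (Metric.mem_ball.1 hz).le
  filter_upwards [hB.eventually hc, hB.eventually (eventually_smallSets_forall.2 h1)] with i h2 h3
  obtain ⟨a, b, h4, h5, hab, h6⟩ := he.evalInterval_eq (B i) h2
  have key : ∀ y ∈ Set.Icc a b, |y - e.eval (extend x)| ≤ η := by
    rw [← h6]
    rintro _ ⟨z, hz, rfl⟩
    exact h3 z hz
  have ha := abs_le.1 (key a ⟨le_rfl, hab⟩)
  have hb := abs_le.1 (key b ⟨hab, le_rfl⟩)
  rw [Interval.Within, h4, h5]
  exact ⟨EReal.coe_le_coe_iff.2 (by linarith), EReal.coe_le_coe_iff.2 (by linarith)⟩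

theorem eventually_scoreInterval_within
    (hB : Tendsto (fun i => realBox (B i)) l (𝓝 x).smallSets) {Ξ : List (SVal F)}
    (ha : ∀ v ∈ Ξ, v.AffineInSamples)
    (hc : ∀ v ∈ Ξ, ∀ᶠ S in (𝓝 x).smallSets, v.ContinuousOnSub S)
    (hx : ∀ v ∈ Ξ, ContinuousAt (fun z : Fin n → ℝ => v.eval (extend z)) x)
    (h0 : ∀ v ∈ Ξ, 0 ≤ v.eval (extend x)) {η : ℝ} (hη : 0 < η) :
    ∀ᶠ i in l, (scoreInterval (intervalEnv (List.ofFn (B i))) Ξ).Within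
      (scoreWeight (extend x) Ξ) η := by
  induction Ξ generalizing η with
  | nil =>
    refine .of_forall fun i => ⟨?_, ?_⟩ <;>
      simp only [scoreInterval, scoreWeight, List.foldr_nil, Interval.point, NNReal.coe_one] <;>
      exact EReal.coe_le_coe_iff.2 (by linarith)
  | cons v Ξ ih =>
    simp only [List.forall_mem_cons] at ha hc h0 hx
    obtain ⟨δ, hδ, h1⟩ := Interval.exists_within_mul (scoreWeight (extend x) Ξ)
      (v.eval (extend x)) hη
    filter_upwards [ih ha.2 hc.2 hx.2 h0.2 hδ, ha.1.eventually_within hB hc.1 hx.1 hδ] with i h2 h3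
    have h4 : (scoreWeight (extend x) (v :: Ξ) : ℝ) =
        scoreWeight (extend x) Ξ * v.eval (extend x) := by
      simp [scoreWeight, h0.1]
    rw [h4]
    exact h1 _ _ h2 h3

end Shrinking

/-- The trace has its entries in the intervals of an interval trace. -/
def InTrace (s : List unitInterval) (t : IntervalTrace) : Prop :=
  List.Forall₂ (fun x J => J.lo ≤ x ∧ x ≤ J.hi) s t

theorem inTrace_ofFn {n : ℕ} {B : Fin n → UInterval} {s : List unitInterval} :
    InTrace s (List.ofFn B) ↔
      ∃ y : Fin n → unitInterval, s = List.ofFn y ∧ ∀ i, (B i).lo ≤ y i ∧ y i ≤ (B i).hi := by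
  rw [InTrace, List.forall₂_iff_get]
  constructor
  · rintro ⟨h1, h2⟩
    rw [List.length_ofFn] at h1
    subst h1
    exact ⟨s.get, (List.ofFn_get s).symm, fun i => by simpa using h2 i i.2 (by simp)⟩
  · rintro ⟨y, rfl, hy⟩
    refine ⟨by simp, fun i h1 h2 => ?_⟩
    simpa using hy _

/-- The interval execution on `t` returns an interval that is contained in `U` or disjoint from it,
its weight varies by at most `ε`, and it encloses the executions on all traces in `t`. -/
def Good (P : Program F) (U : Set ℝ) (ε : ℝ) (t : IntervalTrace) : Prop :=
  ∃ J W, IntReturns P t J W ∧ (J.toSet ⊆ U ∨ Disjoint J.toSet U) ∧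
    W.hi.toENNReal ≤ W.lo.toENNReal + ENNReal.ofReal ε ∧
    ∀ s, InTrace s t → ∃ r ∈ J.toSet, ∃ w : ℝ≥0, Returns P s r w ∧
      W.lo.toENNReal ≤ w ∧ w ≤ W.hi.toENNReal

/-- At almost every point satisfying the path constraints, the finitely many conditions behind
`Good` all persist on small neighbourhoods. -/
theorem IsSymPath.ae_eventually_good (hF : F.Admissible) {P : Program F}
    (hP : UsesSamplesAffinely P) (I : Interval) {ε : ℝ} (hε : 0 < ε) {v : SVal F}
    {c : SymState F} (h : IsSymPath P v c) : ∀ᵐ x : Fin c.n → unitInterval,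
      c.Satisfied (List.ofFn x) → ∀ (l : Filter ℕ) (B : ℕ → Fin c.n → UInterval),
        Tendsto (fun i => realBox (B i)) l (𝓝 fun i => (x i : ℝ)).smallSets →
          ∀ᶠ i in l, Good P I.toSet ε (List.ofFn (B i)) := by
  obtain ⟨hv, hC, hW⟩ := hP v c h
  have hfinC : {C | C ∈ c.constraints}.Finite := c.constraints.finite_toSet
  have hfinW : {W | W ∈ c.scores}.Finite := c.scores.finite_toSet
  filter_upwards [hv.ae_continuousOnSub hF c.n, hv.ae_eventually_mem hF c.n I,
    hv.ae_eventually_mem_of_isOpen hF c.n I.isClosed_toSet.isOpen_compl,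
    (ae_ball_iff hfinC.countable).2 fun C hCm => (hC C hCm).ae_continuousOnSub hF c.n,
    (ae_ball_iff hfinC.countable).2 fun C hCm =>
      (hC C hCm).ae_eventually_holds hF c.n C.rel C.bound,
    (ae_ball_iff hfinW.countable).2 fun W hWm => (hW W hWm).ae_continuousOnSub hF c.n,
    (ae_ball_iff hfinW.countable).2 fun W hWm => (hW W hWm).ae_continuousAt hF c.n]
    with x hv1 hv2 hv3 hC1 hC2 hW1 hW2 hx l B hB
  set cx : Fin c.n → ℝ := fun i => (x i : ℝ) with hcx
  have hsat : ∀ C ∈ c.constraints, C.rel.Holds (C.value.eval (extend cx)) C.bound := by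
    have := hx.2
    rwa [realEnv_ofFn] at this
  -- Needed at the centre `cx` and again at every point of a small box.
  have hge := h.scores_constraints
  have hval : ∀ᶠ S in (𝓝 cx).smallSets, (∀ z ∈ S, v.eval (extend z) ∈ I.toSet) ∨
      ∀ z ∈ S, v.eval (extend z) ∉ I.toSet := by
    -- Membership persists by interval separability, non-membership by continuity, as `I` is closed.
    by_cases hI : v.eval (extend cx) ∈ I.toSet
    · filter_upwards [eventually_smallSets_forall.2 (hv2 hI)] with S hS using .inl hS
    · filter_upwards [eventually_smallSets_forall.2 (hv3 hI)] with S hS using .inr hS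
  have hcon : ∀ᶠ S in (𝓝 cx).smallSets, ∀ C ∈ c.constraints, C.value.ContinuousOnSub S ∧
      ∀ z ∈ S, C.rel.Holds (C.value.eval (extend z)) C.bound := by
    refine (eventually_all_finite hfinC).2 fun C hCm => ?_
    exact (hC1 C hCm).and (eventually_smallSets_forall.2 (hC2 C hCm (hsat C hCm)))
  have hsc : ∀ᶠ S in (𝓝 cx).smallSets, ∀ W ∈ c.scores, W.ContinuousOnSub S :=
    (eventually_all_finite hfinW).2 hW1
  have hwithin := eventually_scoreInterval_within hB hW hW1
    (fun W hWm => (hW2 W hWm).self_of_nhds) (fun W hWm => hsat _ (hge W hWm)) (half_pos hε)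
  filter_upwards [hB.eventually hv1, hB.eventually hval, hB.eventually hcon, hB.eventually hsc,
    hwithin] with i h1 h2 h3 h4 h5
  have hJ := hv.evalInterval_toSet (B i) h1
  refine ⟨_, _, h.intReturns (by simp) ⟨by simp, fun C hCm => ?_⟩, ?_, h5.hi_le_lo_add, ?_⟩
  · exact (hC C hCm).holdsInterval (B i) (h3 C hCm).1 (h3 C hCm).2
  · rw [hJ]
    refine h2.imp (fun h6 => ?_) fun h6 => Set.disjoint_left.2 ?_
    · rintro _ ⟨z, hz, rfl⟩
      exact h6 z hz
    · rintro _ ⟨z, hz, rfl⟩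
      exact h6 z hz
  · intro s hs
    obtain ⟨y, rfl, hy⟩ := inTrace_ofFn.1 hs
    have hyB : (fun j => (y j : ℝ)) ∈ realBox (B i) := ⟨fun j => (hy j).1, fun j => (hy j).2⟩
    have hret := h.returns (s := List.ofFn y) (by simp) ⟨by simp, fun C hCm => by
      rw [realEnv_ofFn]
      exact (h3 C hCm).2 _ hyB⟩
    rw [realEnv_ofFn] at hret
    refine ⟨_, hJ ▸ ⟨_, hyB, rfl⟩, _, hret, ?_⟩
    obtain ⟨h6, h7⟩ := scoreWeight_mem_scoreInterval hW h4 hyB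
      fun W hWm => (h3 _ (hge W hWm)).2 _ hyB
    have h8 := EReal.toENNReal_le_toENNReal h6
    have h9 := EReal.toENNReal_le_toENNReal h7
    rw [EReal.real_coe_toENNReal, ENNReal.ofReal_coe_nnreal] at h8 h9
    exact ⟨h8, h9⟩

end Good

/-! ## Dyadic cells -/

/-- The index of the dyadic interval of level `k` that is chosen for the point `x`. -/
def cellIndex (k : ℕ) (x : unitInterval) : ℕ := min ⌊2 ^ k * (x : ℝ)⌋₊ (2 ^ k - 1)

theorem cellIndex_add_one_le (k : ℕ) (x : unitInterval) : cellIndex k x + 1 ≤ 2 ^ k := by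
  have h1 : cellIndex k x ≤ 2 ^ k - 1 := min_le_right _ _
  have h2 : 0 < 2 ^ k := by positivity
  omega

/-- The dyadic interval of level `k` that is chosen for the point `x`. -/
def cell (k : ℕ) (x : unitInterval) : UInterval where
  lo := ⟨cellIndex k x / 2 ^ k, by positivity, by
    have := cellIndex_add_one_le k x
    rw [div_le_one (by positivity)]
    exact_mod_cast Nat.le_of_succ_le this⟩
  hi := ⟨(cellIndex k x + 1) / 2 ^ k, by positivity, by
    rw [div_le_one (by positivity)]
    exact_mod_cast cellIndex_add_one_le k x⟩
  le := by
    refine Subtype.mk_le_mk.2 ?_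
    gcongr
    linarith

theorem mem_cell (k : ℕ) (x : unitInterval) : (cell k x).lo ≤ x ∧ x ≤ (cell k x).hi := by
  have hx0 : (0 : ℝ) ≤ 2 ^ k * x := mul_nonneg (by positivity) x.2.1
  constructor
  · change (cellIndex k x : ℝ) / 2 ^ k ≤ x
    rw [div_le_iff₀' (by positivity)]
    exact le_trans (Nat.cast_le.2 (min_le_left _ _)) (Nat.floor_le hx0)
  · change (x : ℝ) ≤ ((cellIndex k x : ℝ) + 1) / 2 ^ k
    rw [le_div_iff₀' (by positivity)]
    rcases min_choice ⌊2 ^ k * (x : ℝ)⌋₊ (2 ^ k - 1) with h | h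
    -- The cap `2 ^ k - 1` matters only at `x = 1`, which is thereby put into the last cell.
    · rw [cellIndex, h]
      exact (Nat.lt_floor_add_one _).le
    · rw [cellIndex, h, Nat.cast_sub Nat.one_le_two_pow]
      push_cast
      have := x.2.2
      have h2 : (0 : ℝ) ≤ 2 ^ k := by positivity
      nlinarith

/-- Nesting of dyadic cells: dropping `d` binary digits turns the index of level `j + d` into that
of level `j`. Division is monotone, so it respects the cap in `cellIndex`. -/
theorem cellIndex_div (j d : ℕ) (x : unitInterval) :
    cellIndex (j + d) x / 2 ^ d = cellIndex j x := by
  have hm : Monotone fun a : ℕ => a / 2 ^ d := fun a b h => Nat.div_le_div_right h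
  have h1 : ⌊2 ^ (j + d) * (x : ℝ)⌋₊ / 2 ^ d = ⌊2 ^ j * (x : ℝ)⌋₊ := by
    rw [← Nat.floor_div_natCast]
    congr 1
    push_cast
    rw [pow_add]
    field_simp
  have h2 : (2 ^ (j + d) - 1) / 2 ^ d = 2 ^ j - 1 := by
    have h3 : 0 < 2 ^ d := by positivity
    have h4 : 0 < 2 ^ j := by positivity
    obtain ⟨a, ha⟩ : ∃ a, 2 ^ j = a + 1 := ⟨2 ^ j - 1, by omega⟩
    rw [pow_add, ha]
    refine Nat.div_eq_of_lt_le ?_ ?_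
    · simp only [Nat.add_sub_cancel]
      rw [add_mul]
      omega
    · simp only [Nat.add_sub_cancel]
      have : 0 < (a + 1) * 2 ^ d := by positivity
      omega
  rw [cellIndex, hm.map_min]
  simp only [h1, h2]
  rfl

theorem cell_congr {k : ℕ} {x y : unitInterval} (h : cellIndex k x = cellIndex k y) :
    cell k x = cell k y := by
  simp only [cell, h]

/-- If the finer cell overlaps the coarser one in more than an endpoint, it lies inside it; hence
both points have the same coarse cell. -/
theorem cell_eq_of_not_almostDisjoint {j k : ℕ} (hjk : j ≤ k) {x y : unitInterval}
    (h : ¬ AlmostDisjoint (cell j x) (cell k y)) : cell j x = cell j y := by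
  obtain ⟨d, rfl⟩ := Nat.exists_eq_add_of_le hjk
  refine cell_congr ?_
  simp only [AlmostDisjoint, not_or, not_le] at h
  obtain ⟨h1, h2⟩ := h
  replace h1 : (cellIndex (j + d) y : ℝ) / 2 ^ (j + d) < ((cellIndex j x : ℝ) + 1) / 2 ^ j := h1
  replace h2 : (cellIndex j x : ℝ) / 2 ^ j < ((cellIndex (j + d) y : ℝ) + 1) / 2 ^ (j + d) := h2
  rw [← cellIndex_div j d y]
  have hj : (0 : ℝ) < 2 ^ j := by positivity
  have hd : (0 : ℝ) < 2 ^ d := by positivity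
  rw [pow_add, div_lt_div_iff₀ (by positivity) (by positivity)] at h1 h2
  symm
  refine Nat.div_eq_of_lt_le ?_ ?_
  · refine Nat.lt_succ_iff.1 ?_
    have : (cellIndex j x : ℝ) * 2 ^ d < cellIndex (j + d) y + 1 := by
      refine lt_of_mul_lt_mul_right ?_ hj.le
      nlinarith
    exact_mod_cast this
  · have : (cellIndex (j + d) y : ℝ) < (cellIndex j x + 1) * 2 ^ d := by
      refine lt_of_mul_lt_mul_right ?_ hj.le
      nlinarith
    exact_mod_cast this

theorem tendsto_cell (x : unitInterval) :
    Tendsto (fun k => ((cell k x).lo : ℝ)) atTop (𝓝 x) ∧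
      Tendsto (fun k => ((cell k x).hi : ℝ)) atTop (𝓝 x) := by
  have hw : ∀ k, ((cell k x).hi : ℝ) = (cell k x).lo + (1 / 2) ^ k := by
    intro k
    simp only [cell]
    rw [add_div, one_div_pow]
  have h0 : Tendsto (fun k : ℕ => (1 / 2 : ℝ) ^ k) atTop (𝓝 0) :=
    tendsto_pow_atTop_nhds_zero_of_lt_one (by norm_num) (by norm_num)
  have hlo : ∀ k, ((cell k x).lo : ℝ) ≤ x := fun k => (mem_cell k x).1
  have hhi : ∀ k, (x : ℝ) ≤ (cell k x).hi := fun k => (mem_cell k x).2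
  constructor
  · refine tendsto_of_tendsto_of_tendsto_of_le_of_le (g := fun k => (x : ℝ) - (1 / 2) ^ k)
      (by simpa using tendsto_const_nhds.sub h0) tendsto_const_nhds (fun k => ?_) hlo
    have h1 := hhi k
    rw [hw] at h1
    simpa using h1
  · refine tendsto_of_tendsto_of_tendsto_of_le_of_le (h := fun k => (x : ℝ) + (1 / 2) ^ k)
      tendsto_const_nhds (by simpa using tendsto_const_nhds.add h0) hhi fun k => ?_
    have h1 := hlo k
    rw [hw]
    simpa using h1

theorem tendsto_realBox_cell {n : ℕ} (x : Fin n → unitInterval) :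
    Tendsto (fun k => realBox fun i => cell k (x i)) atTop (𝓝 fun i => (x i : ℝ)).smallSets :=
  Tendsto.Icc (tendsto_pi_nhds.2 fun i => (tendsto_cell (x i)).1)
    (tendsto_pi_nhds.2 fun i => (tendsto_cell (x i)).2)

/-- A cell is determined by its level and its index, and finite sequences over a countable set are
countable. -/
theorem countable_cells : {t : IntervalTrace | ∃ (n k : ℕ) (x : Fin n → unitInterval),
    t = List.ofFn fun i => cell k (x i)}.Countable := by
  have hS : {J : UInterval | ∃ k x, J = cell k x}.Countable := by
    have : {J : UInterval | ∃ k x, J = cell k x} =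
        ⋃ p : ℕ × ℕ, {J | ∃ x, J = cell p.1 x ∧ cellIndex p.1 x = p.2} := by
      ext J
      simp
    rw [this]
    refine Set.countable_iUnion fun p => Set.Subsingleton.countable ?_
    rintro _ ⟨x, rfl, hx⟩ _ ⟨y, rfl, hy⟩
    exact cell_congr (hx.trans hy.symm)
  have := hS.to_subtype
  refine (Set.countable_range
    (List.map (Subtype.val : {J : UInterval | ∃ k x, J = cell k x} → UInterval))).mono ?_
  rintro _ ⟨n, k, x, rfl⟩
  exact ⟨List.ofFn fun i => ⟨cell k (x i), k, x i, rfl⟩, by simp [List.map_ofFn, Function.comp_def]⟩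

/-! ## Measures of interval traces -/

theorem measurableSet_trace_iff {S : Set Trace} :
    MeasurableSet S ↔ ∀ n, MeasurableSet (Sigma.mk n ⁻¹' S) :=
  MeasurableSpace.measurableSet_iInf

theorem measurableEmbedding_traceMk (n : ℕ) :
    MeasurableEmbedding (Sigma.mk (β := fun n => Fin n → unitInterval) n) where
  injective := sigma_mk_injective
  measurable := fun S hS => measurableSet_trace_iff.1 hS n
  measurableSet_image' := by
    intro S hS
    refine measurableSet_trace_iff.2 fun m => ?_
    by_cases h : n = m
    · subst h
      rwa [Set.preimage_image_eq _ sigma_mk_injective]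
    · convert MeasurableSet.empty
      ext x
      simp only [Set.mem_preimage, Set.mem_image, Sigma.mk.injEq, Set.mem_empty_iff_false,
        iff_false, not_exists, not_and]
      exact fun y _ h' => (h h').elim

theorem ae_traceMeasure_iff {p : Trace → Prop} :
    (∀ᵐ s ∂traceMeasure, p s) ↔ ∀ n, ∀ᵐ x : Fin n → unitInterval, p ⟨n, x⟩ := by
  rw [traceMeasure, Measure.ae_sum_iff]
  exact forall_congr' fun n => (measurableEmbedding_traceMk n).ae_map_iff

/-- The traces with entries in the intervals of an interval trace. -/
def traceBox (t : IntervalTrace) : Set Trace := {s | InTrace s.toList t}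

theorem mk_preimage_traceBox_ofFn {n : ℕ} (B : Fin n → UInterval) :
    Sigma.mk n ⁻¹' traceBox (List.ofFn B) =
      Set.univ.pi fun i => Set.Icc (B i).lo (B i).hi := by
  ext x
  simp only [traceBox, Set.mem_preimage, Set.mem_ofPred_eq, Trace.toList, inTrace_ofFn,
    Set.mem_univ_pi, Set.mem_Icc]
  constructor
  · rintro ⟨y, h1, h2⟩
    rw [List.ofFn_injective h1]
    exact h2
  · exact fun h => ⟨x, rfl, h⟩

theorem mk_preimage_traceBox_of_ne {n : ℕ} {t : IntervalTrace} (h : n ≠ t.length) :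
    Sigma.mk n ⁻¹' traceBox t = ∅ := by
  ext x
  simp only [Set.mem_preimage, Set.mem_empty_iff_false, iff_false]
  intro hx
  exact h (by simpa [Trace.toList] using List.Forall₂.length_eq hx)

theorem exists_eq_ofFn (t : IntervalTrace) :
    ∃ B : Fin t.length → UInterval, t = List.ofFn B := ⟨t.get, (List.ofFn_get t).symm⟩

theorem measurableSet_traceBox (t : IntervalTrace) : MeasurableSet (traceBox t) := by
  refine measurableSet_trace_iff.2 fun n => ?_
  by_cases h : n = t.length
  · subst h
    obtain ⟨B, hB⟩ := exists_eq_ofFn t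
    generalize t.length = n at B hB ⊢
    subst hB
    rw [mk_preimage_traceBox_ofFn]
    exact MeasurableSet.univ_pi fun i => measurableSet_Icc
  · rw [mk_preimage_traceBox_of_ne h]
    exact MeasurableSet.empty

theorem volumeOf_ofFn {n : ℕ} (B : Fin n → UInterval) :
    volumeOf (List.ofFn B) = ∏ i, ENNReal.ofReal (((B i).hi : ℝ) - (B i).lo) := by
  simp [volumeOf, List.map_ofFn, List.prod_ofFn]

theorem traceMeasure_traceBox (t : IntervalTrace) : traceMeasure (traceBox t) = volumeOf t := by
  rw [traceMeasure, Measure.sum_apply _ (measurableSet_traceBox t)]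
  simp_rw [(measurableEmbedding_traceMk _).map_apply]
  rw [tsum_eq_single t.length fun n hn => by rw [mk_preimage_traceBox_of_ne hn, measure_empty]]
  obtain ⟨B, hB⟩ := exists_eq_ofFn t
  generalize t.length = n at B hB ⊢
  subst hB
  rw [mk_preimage_traceBox_ofFn, volumeOf_ofFn, volume_pi_pi]
  simp

theorem cover_ofFn {n : ℕ} (B : Fin n → UInterval) :
    cover (List.ofFn B) = Set.pi (Finset.range n : Set ℕ)
      fun i => if h : i < n then Set.Icc (B ⟨i, h⟩).lo (B ⟨i, h⟩).hi else Set.univ := by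
  ext u
  simp only [cover, Set.mem_ofPred_eq, Set.mem_pi, Finset.coe_range, Set.mem_Iio, List.length_ofFn,
    List.getElem_ofFn]
  refine forall_congr' fun i => forall_congr' fun hi => ?_
  rw [dif_pos hi]
  rfl

theorem measurableSet_cover (t : IntervalTrace) : MeasurableSet (cover t) := by
  obtain ⟨B, hB⟩ := exists_eq_ofFn t
  rw [hB, cover_ofFn]
  refine MeasurableSet.pi (Finset.countable_toSet _) fun i _ => ?_
  split_ifs
  · exact measurableSet_Icc
  · exact MeasurableSet.univ

instance : IsProbabilityMeasure infiniteTraceMeasure := by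
  unfold infiniteTraceMeasure
  infer_instance

theorem infiniteTraceMeasure_cover (t : IntervalTrace) :
    infiniteTraceMeasure (cover t) = volumeOf t := by
  obtain ⟨B, hB⟩ := exists_eq_ofFn t
  rw [hB, cover_ofFn, volumeOf_ofFn, infiniteTraceMeasure, Measure.infinitePi_pi, Finset.prod_range]
  · simp
  · intro i _
    split_ifs
    · exact measurableSet_Icc
    · exact MeasurableSet.univ

theorem AlmostDisjoint.exists_eq {I J : UInterval} (h : AlmostDisjoint I J) :
    ∃ c, ∀ x, I.lo ≤ x → x ≤ I.hi → J.lo ≤ x → x ≤ J.hi → x = c := by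
  rcases h with h | h
  · exact ⟨I.hi, fun x _ h1 h2 _ => le_antisymm h1 (h.trans h2)⟩
  · exact ⟨J.hi, fun x h1 _ _ h2 => le_antisymm h2 (h.trans h1)⟩

theorem CompatiblePair.aedisjoint_cover {t t' : IntervalTrace} (h : CompatiblePair t t') :
    AEDisjoint infiniteTraceMeasure (cover t) (cover t') := by
  obtain ⟨i, hi, hi', hd⟩ := h
  obtain ⟨c, hc⟩ := hd.exists_eq
  have h1 : infiniteTraceMeasure ((fun u : ℕ → unitInterval => u i) ⁻¹' {c}) = 0 := by
    rw [infiniteTraceMeasure, (measurePreserving_eval_infinitePi _ i).measure_preimage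
      (measurableSet_singleton c).nullMeasurableSet, measure_singleton]
  refine measure_mono_null (fun u hu => ?_) h1
  exact hc _ (hu.1 i hi).1 (hu.1 i hi).2 (hu.2 i hi').1 (hu.2 i hi').2

/-- A common trace has its `i`-th entry fixed at one point `c`, a null condition on every cube. -/
theorem CompatiblePair.aedisjoint_traceBox {t t' : IntervalTrace} (h : CompatiblePair t t') :
    AEDisjoint traceMeasure (traceBox t) (traceBox t') := by
  obtain ⟨i, hi, hi', hd⟩ := h
  obtain ⟨c, hc⟩ := hd.exists_eq
  have h1 : ∀ᵐ s : Trace ∂traceMeasure, ∀ h : i < s.1, s.2 ⟨i, h⟩ ≠ c := by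
    refine ae_traceMeasure_iff.2 fun n => ?_
    by_cases hn : i < n
    · filter_upwards [Measure.ae_eval_ne (fun _ : Fin n => (volume : Measure unitInterval))
        ⟨i, hn⟩ c] with x hx _
      exact hx
    · exact .of_forall fun x h => (hn h).elim
  refine measure_mono_null (fun s hs => ?_) (ae_iff.1 h1)
  obtain ⟨h2, h3⟩ := hs
  simp only [traceBox, Set.mem_ofPred_eq, InTrace, List.forall₂_iff_get] at h2 h3
  have hl : i < s.toList.length := h2.1 ▸ hi
  have hs1 : i < s.1 := by simpa [Trace.toList] using hl
  obtain ⟨h4, h5⟩ := h2.2 i hl hi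
  obtain ⟨h6, h7⟩ := h3.2 i hl hi'
  have := hc _ h4 h5 h6 h7
  simp only [Set.mem_ofPred_eq, not_forall, not_not]
  exact ⟨hs1, by simpa [Trace.toList] using this⟩

/-! ## The set of maximal good dyadic interval traces -/

section Cells

variable {F : Primitives} {P : Program F} {U : Set ℝ} {ε : ℝ}

/-- The good dyadic interval traces that are not contained in a larger one. -/
def maximalGoodCells (P : Program F) (U : Set ℝ) (ε : ℝ) : Set IntervalTrace :=
  {t | ∃ (n k : ℕ) (x : Fin n → unitInterval), t = List.ofFn (fun i => cell k (x i)) ∧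
    Good P U ε t ∧ ∀ j < k, ¬ Good P U ε (List.ofFn fun i => cell j (x i))}

/-- Intervals that are not almost disjoint share a point; the surplus intervals of `t'` are filled
with left endpoints. -/
theorem exists_inTrace_append {t t' : IntervalTrace} (hl : t.length ≤ t'.length)
    (h : ¬ CompatiblePair t t') : ∃ s q, InTrace s t ∧ InTrace (s ++ q) t' := by
  induction t generalizing t' with
  | nil =>
    refine ⟨[], t'.map UInterval.lo, .nil, ?_⟩
    rw [List.nil_append, InTrace, List.forall₂_map_left_iff, List.forall₂_same]
    exact fun J _ => ⟨le_rfl, J.le⟩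
  | cons J t ih =>
    cases t' with
    | nil => simp at hl
    | cons K t' =>
      have h1 : ¬ AlmostDisjoint J K := fun h1 => h ⟨0, by simp, by simp, h1⟩
      have h2 : ¬ CompatiblePair t t' := fun ⟨i, hi, hi', h2⟩ =>
        h ⟨i + 1, by simpa using hi, by simpa using hi', by simpa using h2⟩
      obtain ⟨s, q, h3, h4⟩ := ih (by simpa using hl) h2
      simp only [AlmostDisjoint, not_or, not_le] at h1
      exact ⟨max J.lo K.lo :: s, q, .cons ⟨le_max_left _ _, max_le J.le h1.1.le⟩ h3,
        .cons ⟨le_max_right _ _, max_le h1.2.le K.le⟩ h4⟩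

theorem CompatiblePair.symm {t t' : IntervalTrace} (h : CompatiblePair t t') :
    CompatiblePair t' t := by
  obtain ⟨i, hi, hi', hd⟩ := h
  exact ⟨i, hi', hi, Or.symm hd⟩

/-- All traces in good interval traces terminate, and terminating traces are prefix-free. -/
theorem Good.length_eq {t t' : IntervalTrace} (ht : Good P U ε t) (ht' : Good P U ε t')
    (h : ¬ CompatiblePair t t') : t.length = t'.length := by
  wlog hl : t.length ≤ t'.length generalizing t t'
  · exact (this ht' ht (fun h' => h h'.symm) (not_le.1 hl).le).symm
  obtain ⟨s, q, h1, h2⟩ := exists_inTrace_append hl h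
  obtain ⟨_, _, -, -, -, h3⟩ := ht
  obtain ⟨_, _, -, -, -, h4⟩ := ht'
  obtain ⟨r, -, w, h5, -⟩ := h3 s h1
  obtain ⟨r', -, w', h6, -⟩ := h4 (s ++ q) h2
  obtain rfl := h5.append_eq_nil h6
  rw [← List.Forall₂.length_eq h1, ← List.Forall₂.length_eq h2, List.append_nil]

/-- Two incompatible members have equal length and overlap in every coordinate, so the finer lies in
the coarser; the coarser is good, against minimality of the finer level. -/
theorem compatible_maximalGoodCells : Compatible (maximalGoodCells P U ε) := by
  rintro t ⟨n, k, x, ht, hg, hmin⟩ t' ⟨n', k', x', ht', hg', hmin'⟩ hne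
  by_contra hcomp
  have hnn : n = n' := by
    have := hg.length_eq hg' hcomp
    rw [ht, ht'] at this
    simpa using this
  subst hnn
  wlog hk : k ≤ k' generalizing t t' k k' x x'
  · exact this k' x' ht' hg' hmin' k hg hne.symm (fun h => hcomp h.symm) x ht hmin
      (not_le.1 hk).le
  have hcell : ∀ i, cell k (x i) = cell k (x' i) := fun i =>
    cell_eq_of_not_almostDisjoint hk fun hd =>
      hcomp ⟨i, by simp [ht], by simp [ht'], by simpa [ht, ht'] using hd⟩
  have heq : t = List.ofFn fun i => cell k (x' i) := by
    rw [ht]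
    simp only [hcell]
  rcases hk.lt_or_eq with hk | rfl
  · exact hmin' k hk (heq ▸ hg)
  · exact hne (heq.trans ht'.symm)

theorem countable_maximalGoodCells : (maximalGoodCells P U ε).Countable :=
  countable_cells.mono fun _ h => by
    obtain ⟨n, k, x, h, -⟩ := h
    exact ⟨n, k, x, h⟩

theorem exists_mem_maximalGoodCells {n : ℕ} {x : Fin n → unitInterval}
    (h : ∃ k, Good P U ε (List.ofFn fun i => cell k (x i))) :
    ∃ t ∈ maximalGoodCells P U ε, InTrace (List.ofFn x) t := by
  classical
  exact ⟨_, ⟨n, Nat.find h, x, rfl, Nat.find_spec h, fun j hj => Nat.find_min h hj⟩,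
    inTrace_ofFn.2 ⟨x, rfl, fun i => mem_cell _ _⟩⟩

/-- Each path contributes one null set of bad points, and the paths are countably many; outside
their union, the cells around a terminating trace are eventually good. -/
theorem ae_mem_maximalGoodCells (hF : F.Admissible) (hP : UsesSamplesAffinely P) (I : Interval)
    (hε : 0 < ε) : ∀ᵐ s ∂traceMeasure, s ∈ valuePreimage P Set.univ →
      s ∈ ⋃ t ∈ maximalGoodCells P I.toSet ε, traceBox t := by
  refine ae_traceMeasure_iff.2 fun n => ?_
  have h1 : ∀ p ∈ {p : SVal F × SymState F | IsSymPath P p.1 p.2},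
      ∀ᵐ x : Fin n → unitInterval, p.2.n = n → p.2.Satisfied (List.ofFn x) →
        ∃ k, Good P I.toSet ε (List.ofFn fun i => cell k (x i)) := by
    rintro ⟨v, c⟩ hp
    by_cases hn : c.n = n
    · subst hn
      filter_upwards [IsSymPath.ae_eventually_good hF hP I hε hp] with x hx _ hsat
      exact (hx hsat atTop _ (tendsto_realBox_cell x)).exists
    · exact .of_forall fun x h => (hn h).elim
  filter_upwards [(ae_ball_iff (countable_isSymPath P)).2 h1] with x hx hval
  obtain ⟨r, -, w, hr⟩ := hval
  obtain ⟨v, c, h2, h3, h4⟩ := hr.exists_isSymPath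
  obtain ⟨t, ht, hxt⟩ := exists_mem_maximalGoodCells
    (hx (v, c) h2 (by simpa [Trace.toList] using h3.symm) h4)
  exact Set.mem_biUnion ht hxt

theorem Good.dichotomy {t : IntervalTrace} (ht : Good P U ε t) :
    (intervalValue P t).toSet ⊆ U ∨ Disjoint (intervalValue P t).toSet U := by
  obtain ⟨J, W, h1, h2, -⟩ := ht
  rwa [intervalValue_eq h1]

/-- Hence the lower and upper bounds sum over the same interval traces. -/
theorem Good.nonempty_inter_iff {t : IntervalTrace} (ht : Good P U ε t) :
    ((intervalValue P t).toSet ∩ U).Nonempty ↔ (intervalValue P t).toSet ⊆ U := by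
  rcases ht.dichotomy with h | h
  · rw [Set.inter_eq_left.2 h]
    exact iff_of_true (Interval.toSet_nonempty _) h
  · rw [h.inter_eq]
    refine iff_of_false Set.not_nonempty_empty fun h' => ?_
    obtain ⟨x, hx⟩ := (intervalValue P t).toSet_nonempty
    exact Set.disjoint_left.1 h hx (h' hx)

theorem Good.intervalWeight_hi_le {t : IntervalTrace} (ht : Good P U ε t) :
    (intervalWeight P t).hi.toENNReal ≤
      (intervalWeight P t).lo.toENNReal + ENNReal.ofReal ε := by
  obtain ⟨J, W, h1, -, h2, -⟩ := ht
  rwa [intervalWeight_eq h1]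

theorem Good.returns {t : IntervalTrace} (ht : Good P U ε t) {s : Trace} (hs : s ∈ traceBox t) :
    ∃ r ∈ (intervalValue P t).toSet, ∃ w, Returns P s.toList r w ∧
      (intervalWeight P t).lo.toENNReal ≤ weight P s ∧
      weight P s ≤ (intervalWeight P t).hi.toENNReal := by
  obtain ⟨J, W, h1, -, -, h2⟩ := ht
  obtain ⟨r, hr, w, h3, h4⟩ := h2 _ hs
  rw [intervalWeight_eq h1, intervalValue_eq h1, weight_eq h3]
  exact ⟨r, hr, w, h3, h4⟩

end Cells

/-! ## Bounds -/

section Bounds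

variable {F : Primitives} {P : Program F} {U : Set ℝ} {ε : ℝ} {T : Set IntervalTrace}

theorem lowerBound_eq_tsum : lowerBound P T U =
    ∑' t : {t ∈ T | (intervalValue P t).toSet ⊆ U},
      volumeOf t.1 * (intervalWeight P t.1).lo.toENNReal := by
  classical
  rw [lowerBound, tsum_subtype T fun t => volumeOf t * (intervalWeight P t).lo.toENNReal *
    (if (intervalValue P t).toSet ⊆ U then 1 else 0),
    tsum_subtype {t ∈ T | (intervalValue P t).toSet ⊆ U} fun t =>
      volumeOf t * (intervalWeight P t).lo.toENNReal]
  refine tsum_congr fun t => ?_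
  by_cases h1 : t ∈ T <;> by_cases h2 : (intervalValue P t).toSet ⊆ U <;> simp [h1, h2]

theorem upperBound_eq_tsum (hT : ∀ t ∈ T, Good P U ε t) : upperBound P T U =
    ∑' t : {t ∈ T | (intervalValue P t).toSet ⊆ U},
      volumeOf t.1 * (intervalWeight P t.1).hi.toENNReal := by
  classical
  rw [upperBound, tsum_subtype T fun t => volumeOf t * (intervalWeight P t).hi.toENNReal *
    (if ((intervalValue P t).toSet ∩ U).Nonempty then 1 else 0),
    tsum_subtype {t ∈ T | (intervalValue P t).toSet ⊆ U} fun t =>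
      volumeOf t * (intervalWeight P t).hi.toENNReal]
  refine tsum_congr fun t => ?_
  by_cases h1 : t ∈ T
  · by_cases h2 : (intervalValue P t).toSet ⊆ U <;>
      simp [h1, h2, (hT t h1).nonempty_inter_iff]
  · simp [h1]

theorem tsum_volumeOf (hT : T.Countable) (hc : Compatible T) :
    ∑' t : T, volumeOf t.1 = traceMeasure (⋃ t ∈ T, traceBox t) := by
  rw [measure_biUnion₀ hT (fun t ht t' ht' h => (hc ht ht' h).aedisjoint_traceBox)
    fun t _ => (measurableSet_traceBox t).nullMeasurableSet]
  simp only [traceMeasure_traceBox]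

/-- An interval trace has the same volume as a set of finite and of infinite traces, and
compatibility makes both families almost disjoint; so their unions have equal measure. -/
theorem Compatible.exhaustive (hT : T.Countable) (hc : Compatible T)
    (h1 : traceMeasure (⋃ t ∈ T, traceBox t) = 1) : Exhaustive T := by
  have h2 : infiniteTraceMeasure (⋃ t ∈ T, cover t) = 1 := by
    rw [measure_biUnion₀ hT (fun t ht t' ht' h => (hc ht ht' h).aedisjoint_cover)
      fun t _ => (measurableSet_cover t).nullMeasurableSet]
    simp only [infiniteTraceMeasure_cover]
    rw [tsum_volumeOf hT hc, h1]
  exact (prob_compl_eq_zero_iff (MeasurableSet.biUnion hT fun t _ => measurableSet_cover t)).2 h2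

theorem biUnion_traceBox_subset (hT : ∀ t ∈ T, Good P U ε t) :
    ⋃ t ∈ T, traceBox t ⊆ valuePreimage P Set.univ := by
  intro s hs
  obtain ⟨t, ht, hst⟩ := Set.mem_iUnion₂.1 hs
  obtain ⟨r, -, w, hr, -⟩ := (hT t ht).returns hst
  exact ⟨r, trivial, w, hr⟩

/-- Up to a null set, `valuePreimage P U` is the union of the boxes with value inside `U`. This also
avoids asking whether it or the weight is measurable. -/
theorem denotation_eq_tsum (hT : T.Countable) (hc : Compatible T) (hg : ∀ t ∈ T, Good P U ε t)
    (hcov : ∀ᵐ s ∂traceMeasure, s ∈ valuePreimage P Set.univ → s ∈ ⋃ t ∈ T, traceBox t) :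
    denotation P U = ∑' t : {t ∈ T | (intervalValue P t).toSet ⊆ U},
      ∫⁻ s in traceBox t.1, weight P s ∂traceMeasure := by
  have hae : valuePreimage P U =ᵐ[traceMeasure]
      (⋃ t ∈ {t ∈ T | (intervalValue P t).toSet ⊆ U}, traceBox t : Set Trace) := by
    filter_upwards [hcov] with s hs
    refine propext ⟨fun hsU => ?_, fun hsU => ?_⟩
    · obtain ⟨r, hrU, w, hr⟩ := hsU
      obtain ⟨t, ht, hst⟩ := Set.mem_iUnion₂.1 (hs ⟨r, trivial, w, hr⟩)
      refine Set.mem_biUnion (x := t) ⟨ht, ?_⟩ hst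
      obtain ⟨r', hr'J, w', hr', -⟩ := (hg t ht).returns hst
      obtain ⟨rfl, -⟩ := hr.unique hr'
      exact (hg t ht).nonempty_inter_iff.1 ⟨r, hr'J, hrU⟩
    · obtain ⟨t, ⟨ht, htU⟩, hst⟩ := Set.mem_iUnion₂.1 hsU
      obtain ⟨r, hrJ, w, hr, -⟩ := (hg t ht).returns hst
      exact ⟨r, htU hrJ, w, hr⟩
  rw [denotation, Measure.restrict_congr_set hae]
  exact lintegral_biUnion₀ (hT.mono (Set.sep_subset _ _))
    (fun t _ => (measurableSet_traceBox t).nullMeasurableSet)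
    (fun t ht t' ht' h => (hc ht.1 ht'.1 h).aedisjoint_traceBox) _

theorem lowerBound_le_denotation (hT : T.Countable) (hc : Compatible T)
    (hg : ∀ t ∈ T, Good P U ε t)
    (hcov : ∀ᵐ s ∂traceMeasure, s ∈ valuePreimage P Set.univ → s ∈ ⋃ t ∈ T, traceBox t) :
    lowerBound P T U ≤ denotation P U := by
  rw [lowerBound_eq_tsum, denotation_eq_tsum hT hc hg hcov]
  refine ENNReal.tsum_le_tsum fun ⟨t, ht⟩ => ?_
  rw [← traceMeasure_traceBox, mul_comm, ← setLIntegral_const]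
  refine setLIntegral_mono' (measurableSet_traceBox t) fun s hs => ?_
  obtain ⟨_, -, _, -, h, -⟩ := (hg t ht.1).returns hs
  exact h

theorem denotation_le_upperBound (hT : T.Countable) (hc : Compatible T)
    (hg : ∀ t ∈ T, Good P U ε t)
    (hcov : ∀ᵐ s ∂traceMeasure, s ∈ valuePreimage P Set.univ → s ∈ ⋃ t ∈ T, traceBox t) :
    denotation P U ≤ upperBound P T U := by
  rw [upperBound_eq_tsum hg, denotation_eq_tsum hT hc hg hcov]
  refine ENNReal.tsum_le_tsum fun ⟨t, ht⟩ => ?_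
  rw [← traceMeasure_traceBox, mul_comm, ← setLIntegral_const]
  refine setLIntegral_mono' (measurableSet_traceBox t) fun s hs => ?_
  obtain ⟨_, -, _, -, -, h⟩ := (hg t ht.1).returns hs
  exact h

theorem upperBound_le_lowerBound_add (hT : T.Countable) (hc : Compatible T)
    (hg : ∀ t ∈ T, Good P U ε t) (h1 : traceMeasure (⋃ t ∈ T, traceBox t) ≤ 1) :
    upperBound P T U ≤ lowerBound P T U + ENNReal.ofReal ε := by
  rw [upperBound_eq_tsum hg, lowerBound_eq_tsum]
  set S := {t ∈ T | (intervalValue P t).toSet ⊆ U} with hS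
  have hST : S ⊆ T := Set.sep_subset _ _
  calc ∑' t : S, volumeOf t.1 * (intervalWeight P t.1).hi.toENNReal
      ≤ ∑' t : S, (volumeOf t.1 * (intervalWeight P t.1).lo.toENNReal +
          volumeOf t.1 * ENNReal.ofReal ε) := by
        refine ENNReal.tsum_le_tsum fun t => ?_
        rw [← mul_add]
        gcongr
        exact (hg t.1 (hST t.2)).intervalWeight_hi_le
    _ = (∑' t : S, volumeOf t.1 * (intervalWeight P t.1).lo.toENNReal) +
          (∑' t : S, volumeOf t.1) * ENNReal.ofReal ε := by
        rw [ENNReal.tsum_add, ENNReal.tsum_mul_right]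
    _ ≤ (∑' t : S, volumeOf t.1 * (intervalWeight P t.1).lo.toENNReal) +
          1 * ENNReal.ofReal ε := by
        gcongr
        -- The error is `ε` times a total volume, and that volume is at most one.
        rw [tsum_volumeOf (hT.mono hST) (hc.mono hST)]
        exact (measure_mono (Set.biUnion_subset_biUnion_left hST)).trans h1
    _ = _ := by rw [one_mul]

end Bounds

end SPCF

end

theorem mainTheorem1 (F : SPCF.Primitives) (hF : F.Admissible)
    (P : SPCF.Program F) (hterm : SPCF.AlmostSurelyTerminating P)
    (hsample : SPCF.UsesSamplesAffinely P)
    (I : SPCF.Interval) (ε : ℝ) (hε : 0 < ε) :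
    ∃ T : Set SPCF.IntervalTrace, T.Countable ∧ SPCF.Compatible T ∧ SPCF.Exhaustive T ∧
      SPCF.upperBound P T I.toSet - ENNReal.ofReal ε ≤ SPCF.denotation P I.toSet ∧
      SPCF.denotation P I.toSet ≤ SPCF.lowerBound P T I.toSet + ENNReal.ofReal ε := by
  have hT := SPCF.countable_maximalGoodCells (P := P) (U := I.toSet) (ε := ε)
  have hc := SPCF.compatible_maximalGoodCells (P := P) (U := I.toSet) (ε := ε)
  have hg : ∀ t ∈ SPCF.maximalGoodCells P I.toSet ε, SPCF.Good P I.toSet ε t :=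
    fun t ⟨_, _, _, _, h, _⟩ => h
  have hcov := SPCF.ae_mem_maximalGoodCells hF hsample I hε
  -- Good boxes contain only terminating traces, and they contain almost all of them.
  have h1 : SPCF.traceMeasure (⋃ t ∈ SPCF.maximalGoodCells P I.toSet ε, SPCF.traceBox t) = 1 := by
    rw [← show SPCF.traceMeasure (SPCF.valuePreimage P Set.univ) = 1 from hterm]
    exact le_antisymm (MeasureTheory.measure_mono (SPCF.biUnion_traceBox_subset hg))
      (MeasureTheory.measure_mono_ae hcov)
  have hle := SPCF.upperBound_le_lowerBound_add hT hc hg h1.le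
  -- Both inequalities come from lower ≤ denotation ≤ upper ≤ lower + `ε`.
  refine ⟨_, hT, hc, hc.exhaustive hT h1, tsub_le_iff_right.2 (hle.trans ?_),
    (SPCF.denotation_le_upperBound hT hc hg hcov).trans hle⟩
  gcongr
  exact SPCF.lowerBound_le_denotation hT hc hg hcov
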